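/- **Notation.** Let $\mathbb H=\{\tau\in\mathbb C:\operatorname{Im}\tau>0\}$ and $q^x=e^{2\pi i\tau x}$. For $m\in\frac12\mathbb Z_{>0}$ and $s\in\frac12\mathbb Z$ put $$\Phi_1^{[m,s]}(\tau,z_1,z_2,t)=e^{-2\pi imt}\sum_{j\in\mathbb Z}\frac{e^{2\pi imj(z_1+z_2)+2\pi isz_1}q^{mj^2+sj}}{1-e^{2\pi iz_1}q^j},\qquad \Phi_2^{[m,s]}(\tau,z_1,z_2,t)=e^{-2\pi imt}\sum_{j\in\mathbb Z}\frac{e^{-2\pi imj(z_1+z_2)-2\pi isz_2}q^{mj^2+sj}}{1-e^{-2\pi iz_2}q^j},$$ and $\Phi^{[m,s]}=\Phi_1^{[m,s]}-\Phi_2^{[m,s]}$. Let $E(x)=2\int_0^xe^{-\pi u^2}du$, $\theta_{k,m}(\tau,z)=\sum_{j\in\mathbb Z}e^{2\pi im(j+\frac k{2m})z}q^{m(j+\frac k{2m})^2}$ and $$R_{j;m}(\tau,w)=\sum_{n\equiv j\ (2m)}\Big\{\operatorname{sgn}\big(n-\tfrac12-j+2m\big)-E\Big(\big(n-2m\tfrac{\operatorname{Im}w}{\operatorname{Im}\tau}\big)\sqrt{\tfrac{\operatorname{Im}\tau}{m}}\Big)\Big\}e^{-\frac{\pi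 in^2\tau}{2m}+2\pi inw}.$$ The modification of $\Phi^{[m,s]}$ is $$\widetilde\Phi^{[m,s]}(\tau,z_1,z_2,t)=\Phi^{[m,s]}(\tau,z_1,z_2,t)-\tfrac12e^{-2\pi imt}\sum_{k\in s+\mathbb Z,\ s\le k<s+2m}R_{k;m}\Big(\tau,\frac{z_1-z_2}2\Big)\big[\theta_{k,m}-\theta_{-k,m}\big](\tau,z_1+z_2).$$ Let $\eta$ be the Dedekind eta function and $\vartheta_{ab}(\tau,z)=\sum_{n\in\mathbb Z}e^{\pi i(n+\frac a2)^2\tau+2\pi i(n+\frac a2)(z+\frac b2)}$ $(a,b\in\{0,1\})$. The (super, twisted) denominators of the $N=3$ superconformal algebra are $$R^{(+)}=\eta(\tfrac\tau2)\eta(2\tau)\frac{\vartheta_{11}(\tau,z)}{\vartheta_{00}(\tau,z)},\qquad R^{(-)}=\frac{\eta(\tau)^3}{\eta(\frac\tau2)}\frac{\vartheta_{11}(\tau,z)}{\vartheta_{01}(\tau,z)},\qquad R^{\rm tw}=\frac1{\sqrt2}\frac{\eta(\tau)^3}{\eta(2\tau)}\frac{\vartheta_{11}(\tau,z)}{\vartheta_{10}(\tau,z)}.$$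 For a positive integer $m$ put $K(m)=-\frac{m+2}4$. For an integer $0\le m_2\le m$ the modified character, supercharacter and twisted characters of the $N=3$ module $H(\Lambda^{[K(m),m_2]})$ are, with $s=\frac{m_2+1}2$, $$\mathrm{ch}^{(+)}_{m_2}=\frac{\widetilde\Phi^{[\frac m2,s]}(2\tau,z+\frac\tau2-\frac12,z-\frac\tau2+\frac12,\frac\tau8)}{R^{(+)}(\tau,z)},\qquad \mathrm{ch}^{(-)}_{m_2}=\frac{\widetilde\Phi^{[\frac m2,s]}(2\tau,z+\frac\tau2,z-\frac\tau2,\frac\tau8)}{R^{(-)}(\tau,z)},$$ $$\mathrm{ch}^{\sigma_+}_{m_2}=\frac{\widetilde\Phi^{[\frac m2,s]}(2\tau,z+\tau-\frac12,z-\tau+\frac12,\frac\tau2)}{R^{\rm tw}(\tau,z)},\qquad \mathrm{ch}^{\sigma_-}_{m_2}=\frac{\widetilde\Phi^{[\frac m2,s]}(2\tau,z-\frac12,z+\frac12,0)}{R^{\rm tw}(\tau,z)}.$$ Put $p=1$ if $m$ is even and $p=0$ if $m$ is odd. **Proposition.** Let $m$ be a positive integer. The following identities hold for all $\tau\in\mathbb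 H$ and $z\in\mathbb C$ with $\vartheta_{11}(\tau,z)\ne0$ and $\vartheta_{ab}(\tau,z)\neq0$, where $\vartheta_{ab}$ is the theta function in the denominator that defines the functions on the right-hand side ($\vartheta_{00}$ for $\mathrm{ch}^{(+)}$, $\vartheta_{01}$ for $\mathrm{ch}^{(-)}$, $\vartheta_{10}$ for $\mathrm{ch}^{\sigma_\pm}$). Functions on the right are evaluated at $(\tau,z)$. 1) $S$-transformation: * (i) $\mathrm{ch}^{(+)}_0(-\frac1\tau,\frac z\tau)=-\frac12e^{-\frac{\pi im}4}e^{\frac{\pi imz^2}{2\tau}}\{(1-e^{\frac{\pi im}2})\mathrm{ch}^{(+)}_1-(e^{\frac{\pi im}2}+1)\mathrm{ch}^{(+)}_0\}$ * (ii) $\mathrm{ch}^{(+)}_1(-\frac1\tau,\frac z\tau)=-\frac12e^{-\frac{\pi im}4}e^{\frac{\pi imz^2}{2\tau}}\{(1+e^{\frac{\pi im}2})\mathrm{ch}^{(+)}_1+(e^{\frac{\pi im}2}-1)\mathrm{ch}^{(+)}_0\}$ * (iii) $\mathrm{ch}^{(-)}_0(-\frac1\tau,\frac z\tau)=-\frac12e^{\frac{\pi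 imz^2}{2\tau}}\{\mathrm{ch}^{\sigma_-}_1-e^{\frac{\pi im}2}\mathrm{ch}^{\sigma_+}_{p}\}$ * (iv) $\mathrm{ch}^{(-)}_1(-\frac1\tau,\frac z\tau)=-\frac12e^{\frac{\pi imz^2}{2\tau}}\{\mathrm{ch}^{\sigma_-}_1+e^{\frac{\pi im}2}\mathrm{ch}^{\sigma_+}_{p}\}$ * (v) $\mathrm{ch}^{\sigma_+}_{p}(-\frac1\tau,\frac z\tau)=e^{-\frac{\pi im}2}e^{\frac{\pi imz^2}{2\tau}}\{\mathrm{ch}^{(-)}_0-\mathrm{ch}^{(-)}_1\}$ * (vi) $\mathrm{ch}^{\sigma_-}_1(-\frac1\tau,\frac z\tau)=-e^{\frac{\pi imz^2}{2\tau}}\{\mathrm{ch}^{(-)}_0+\mathrm{ch}^{(-)}_1\}$ 2) $T$-transformation: * (i) $\mathrm{ch}^{(+)}_0(\tau+1,z)=e^{-(\frac m8+\frac{11}{24})\pi i}\,\mathrm{ch}^{(-)}_0$ * (ii) $\mathrm{ch}^{(+)}_1(\tau+1,z)=e^{-(\frac m8+\frac{11}{24})\pi i}\,\mathrm{ch}^{(-)}_1$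 * (iii) $\mathrm{ch}^{(-)}_0(\tau+1,z)=-e^{-(\frac m8+\frac{11}{24})\pi i}\,\mathrm{ch}^{(+)}_0$ * (iv) $\mathrm{ch}^{(-)}_1(\tau+1,z)=e^{-(\frac m8+\frac{11}{24})\pi i}\,\mathrm{ch}^{(+)}_1$ * (v) $\mathrm{ch}^{\sigma_+}_{p}(\tau+1,z)=e^{(\frac m2-\frac1{12})\pi i}\,\mathrm{ch}^{\sigma_+}_{p}$ * (vi) $\mathrm{ch}^{\sigma_-}_1(\tau+1,z)=e^{-\frac{\pi i}{12}}\,\mathrm{ch}^{\sigma_-}_1$ 3) The complex span of the six functions $\mathrm{ch}^{(\pm)}_0,\mathrm{ch}^{(\pm)}_1,\mathrm{ch}^{\sigma_+}_{p},\mathrm{ch}^{\sigma_-}_1$ is closed under the action $$(F|\gamma)(\tau,z)=e^{-\frac{\pi imcz^2}{2(c\tau+d)}}F\Big(\frac{a\tau+b}{c\tau+d},\frac z{c\tau+d}\Big),\qquad\gamma=\begin{pmatrix}a&b\\c&d\end{pmatrix}\in SL_2(\mathbb Z),$$ where functions are compared at the points $(\tau,z)$ at which none of $\vartheta_{00},\vartheta_{01},\vartheta_{10},\vartheta_{11}$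 vanishes. -/

import Mathlib

open scoped UpperHalfPlane MatrixGroups

noncomputable section

namespace N3

/-- The Appell function `Φ₁^{[m,s]}(τ, z₁, z₂, t)`, where `q ^ x = exp (2πiτx)`. -/
def Phi1 (m s : ℝ) (τ z₁ z₂ t : ℂ) : ℂ :=
  Complex.exp (-2 * Real.pi * Complex.I * m * t) *
    ∑' j : ℤ,
      Complex.exp (2 * Real.pi * Complex.I * m * j * (z₁ + z₂)
          + 2 * Real.pi * Complex.I * s * z₁
          + 2 * Real.pi * Complex.I * τ * (m * j ^ 2 + s * j)) /
        (1 - Complex.exp (2 * Real.pi * Complex.I * z₁ + 2 * Real.pi * Complex.I * τ * j))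

/-- The Appell function `Φ₂^{[m,s]}(τ, z₁, z₂, t)`. -/
def Phi2 (m s : ℝ) (τ z₁ z₂ t : ℂ) : ℂ :=
  Complex.exp (-2 * Real.pi * Complex.I * m * t) *
    ∑' j : ℤ,
      Complex.exp (-2 * Real.pi * Complex.I * m * j * (z₁ + z₂)
          - 2 * Real.pi * Complex.I * s * z₂
          + 2 * Real.pi * Complex.I * τ * (m * j ^ 2 + s * j)) /
        (1 - Complex.exp (-2 * Real.pi * Complex.I * z₂ + 2 * Real.pi * Complex.I * τ * j))

/-- The mock theta function `Φ^{[m,s]} = Φ₁^{[m,s]} - Φ₂^{[m,s]}`. -/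
def Phi (m s : ℝ) (τ z₁ z₂ t : ℂ) : ℂ :=
  Phi1 m s τ z₁ z₂ t - Phi2 m s τ z₁ z₂ t

/-- The error function `E(x) = 2 ∫₀ˣ exp (-π u²) du`. -/
def errE (x : ℝ) : ℝ :=
  2 * ∫ u in (0 : ℝ)..x, Real.exp (-Real.pi * u ^ 2)

/-- The function `R_{j;m}(τ, w)` of Zwegers; the sum over `n ≡ j mod 2m` is
written as the sum over `n = j + 2ml` with `l ∈ ℤ`. -/
def zwegersR (j m : ℝ) (τ w : ℂ) : ℂ :=
  ∑' l : ℤ,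
    ((Real.sign ((j + 2 * m * l) - 1 / 2 - j + 2 * m)
        - errE (((j + 2 * m * l) - 2 * m * (w.im / τ.im)) * Real.sqrt (τ.im / m)) : ℝ) : ℂ) *
      Complex.exp (-(Real.pi * Complex.I * ((j + 2 * m * l : ℝ) : ℂ) ^ 2 * τ) / (2 * m)
        + 2 * Real.pi * Complex.I * ((j + 2 * m * l : ℝ) : ℂ) * w)

/-- The Jacobi theta function `θ_{k,m}(τ, z)`. -/
def thetaKM (k m : ℝ) (τ z : ℂ) : ℂ :=
  ∑' j : ℤ,
    Complex.exp (2 * Real.pi * Complex.I * m * (j + k / (2 * m)) * z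
      + 2 * Real.pi * Complex.I * τ * (m * (j + k / (2 * m)) ^ 2))

/-- The correction term `Φ_add^{[m;s]}`; the sum over `k ∈ s + ℤ` with `s ≤ k < s + 2m`
is written as the sum over `k = s + r` with `r ∈ ℕ`, `r < 2m`. -/
def PhiAdd (m s : ℝ) (τ z₁ z₂ t : ℂ) : ℂ :=
  -(1 / 2) * Complex.exp (-2 * Real.pi * Complex.I * m * t) *
    ∑ r ∈ Finset.range ⌈2 * m⌉₊,
      zwegersR (s + r) m τ ((z₁ - z₂) / 2) *
        (thetaKM (s + r) m τ (z₁ + z₂) - thetaKM (-(s + r)) m τ (z₁ + z₂))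

/-- The modification `Φ̃^{[m;s]} = Φ^{[m;s]} + Φ_add^{[m;s]}`. -/
def PhiTilde (m s : ℝ) (τ z₁ z₂ t : ℂ) : ℂ :=
  Phi m s τ z₁ z₂ t + PhiAdd m s τ z₁ z₂ t

/-- The theta functions of Mumford,
`ϑ_{ab}(τ, z) = ∑ₙ exp (πi (n + a/2)² τ + 2πi (n + a/2)(z + b/2))`. -/
def vartheta (a b : ℕ) (τ z : ℂ) : ℂ :=
  ∑' n : ℤ, Complex.exp (Real.pi * Complex.I * ((n : ℂ) + a / 2) ^ 2 * τ
    + 2 * Real.pi * Complex.I * ((n : ℂ) + a / 2) * (z + b / 2))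

/-- The denominator `R^{(+)}` of the N=3 superconformal algebra. -/
def RPlus (τ z : ℂ) : ℂ :=
  ModularForm.eta (τ / 2) * ModularForm.eta (2 * τ) * (vartheta 1 1 τ z / vartheta 0 0 τ z)

/-- The superdenominator `R^{(-)}` of the N=3 superconformal algebra. -/
def RMinus (τ z : ℂ) : ℂ :=
  ModularForm.eta τ ^ 3 / ModularForm.eta (τ / 2) * (vartheta 1 1 τ z / vartheta 0 1 τ z)

/-- The twisted denominator `R^{(+)tw}` of the N=3 superconformal algebra. -/
def RTw (τ z : ℂ) : ℂ :=
  1 / (Real.sqrt 2 : ℂ) * (ModularForm.eta τ ^ 3 / ModularForm.eta (2 * τ)) *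
    (vartheta 1 1 τ z / vartheta 1 0 τ z)

/-- The modified character of `H(Λ^{[K(m), m₂]})`, where `K(m) = -(m+2)/4`. -/
def chPlus (m m₂ : ℕ) (τ z : ℂ) : ℂ :=
  PhiTilde ((m : ℝ) / 2) (((m₂ : ℝ) + 1) / 2) (2 * τ)
    (z + τ / 2 - 1 / 2) (z - τ / 2 + 1 / 2) (τ / 8) / RPlus τ z

/-- The modified supercharacter of `H(Λ^{[K(m), m₂]})`. -/
def chMinus (m m₂ : ℕ) (τ z : ℂ) : ℂ :=
  PhiTilde ((m : ℝ) / 2) (((m₂ : ℝ) + 1) / 2) (2 * τ)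
    (z + τ / 2) (z - τ / 2) (τ / 8) / RMinus τ z

/-- The modified character of `H(Λ^{[K(m), m₂]})` twisted by `σ₊`. -/
def chTwPlus (m m₂ : ℕ) (τ z : ℂ) : ℂ :=
  PhiTilde ((m : ℝ) / 2) (((m₂ : ℝ) + 1) / 2) (2 * τ)
    (z + τ - 1 / 2) (z - τ + 1 / 2) (τ / 2) / RTw τ z

/-- The modified character of `H(Λ^{[K(m), m₂]})` twisted by `σ₋`. -/
def chTwMinus (m m₂ : ℕ) (τ z : ℂ) : ℂ :=
  PhiTilde ((m : ℝ) / 2) (((m₂ : ℝ) + 1) / 2) (2 * τ)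
    (z - 1 / 2) (z + 1 / 2) 0 / RTw τ z

/-- `p(m) = 1` for even `m` and `p(m) = 0` for odd `m`. -/
def par (m : ℕ) : ℕ := if Even m then 1 else 0

/-- The quotient `Φ̃ / R`, with a denominator `R` that is a multiple of `ϑ₁₁ / ϑ_{ab}`, is given by
its formula at `(τ, z)`: neither theta function vanishes there. The points where a term of `Φ̃` has
a pole are zeros of `ϑ_{ab}`. -/
def Regular (a b : ℕ) (τ z : ℂ) : Prop :=
  vartheta 1 1 τ z ≠ 0 ∧ vartheta a b τ z ≠ 0

/-- The complex span of the six modified (super, twisted) characters. -/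
def charSpace (m : ℕ) : Submodule ℂ (ℍ → ℂ → ℂ) :=
  Submodule.span ℂ
    {(fun (τ : ℍ) z => chPlus m 0 τ z : ℍ → ℂ → ℂ), (fun (τ : ℍ) z => chPlus m 1 τ z),
     (fun (τ : ℍ) z => chMinus m 0 τ z), (fun (τ : ℍ) z => chMinus m 1 τ z),
     (fun (τ : ℍ) z => chTwPlus m (par m) τ z), (fun (τ : ℍ) z => chTwMinus m 1 τ z)}

/-- The action of `SL₂(ℤ)` of weight `0` and index `m / 4` on functions of `(τ, z)`:
`(F|γ)(τ, z) = exp (-πi m c z² / (2(cτ + d))) F((aτ + b)/(cτ + d), z/(cτ + d))`. -/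
def slash (m : ℕ) (γ : SL(2, ℤ)) (F : ℍ → ℂ → ℂ) : ℍ → ℂ → ℂ := fun τ z =>
  Complex.exp (-(Real.pi * Complex.I * m * (γ 1 0 : ℤ) * z ^ 2) /
      (2 * ((γ 1 0 : ℤ) * (τ : ℂ) + (γ 1 1 : ℤ)))) *
    F (γ • τ) (z / ((γ 1 0 : ℤ) * (τ : ℂ) + (γ 1 1 : ℤ)))

end N3

end

namespace N3

section

open Complex
open scoped Real

/-! ### Gaussian sums -/

/-! The modified function `PhiTilde` is a sum, over half periods ν = (aτ + c)/2, of the kernel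
exp(-πm(z² + |ν|² + 2ν̄z)/(4 Im τ))/(z + ν), weighted by a function of (a, c) that does not depend
on τ or z (`PhiTilde_eq_latticeSum`). The kernel depends on τ only through ν and Im τ. Hence T and S
merely permute the pairs (a, c), and S adds the factor τ·exp(πimz²/(2τ)) (`latticeSum_T`,
`latticeSum_S`). All modular behaviour of the numerators thus becomes a comparison of weights on ℤ².

The lattice sum comes from `geometric_sub_errSeries`, which contains a free real parameter β. By
Poisson summation both sides have the same derivative in β. The difference of the sides is therefore
constant, yet β ↦ β + 1 multiplies it by exp(2πiU) ≠ 1, so it is zero. Applied with U = z₁ + jτ and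
summed over j, it absorbs the products Rθ and leaves a sum over the period lattice
(`modifiedAppell_eq_tsum`).

The weights are explicit phases, compared by reducing exponents modulo 2 (`plusWeight_S`,
`minusWeight_S`, `twPlusWeight_S`, `twMinusWeight_S` and the corresponding lemmas for T). The
denominators transform by the theta and eta laws, together with a product identity for η at half
arguments (`eta_half_mul_eta_half`). Under S they contribute -τ, which cancels the weight of the
numerators. Closure of the span follows because S and T generate SL₂(ℤ) and both preserve the points
where all the characters are regular (`preservesCharSpace`). -/

lemma summable_exp_quadratic {a : ℝ} (ha : 0 < a) (b : ℝ) :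
    Summable fun n : ℤ => Real.exp (-a * n ^ 2 + b * n) := by
  -- The summand is the norm of a term of a Jacobi theta series with modulus ia/π.
  have h := (summable_jacobiTheta₂_term_iff (-(b / (2 * π) : ℝ) * I) ((a / π : ℝ) * I)).mpr
    (by simpa using div_pos ha Real.pi_pos)
  refine h.norm.congr fun n => ?_
  rw [norm_jacobiTheta₂_term]
  congr 1
  simp only [neg_mul, neg_im, im_ofReal_mul, I_im, mul_one]
  field_simp
  ring

lemma exp_ne_one_of_add_int_ne_zero {U : ℂ} (hU : ∀ b : ℤ, U + b ≠ 0) :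
    cexp (2 * π * I * U) ≠ 1 := by
  rw [Ne, Complex.exp_eq_one_iff]
  rintro ⟨n, hn⟩
  have hpi : (2 * π * I : ℂ) ≠ 0 := by simp [Real.pi_ne_zero]
  have : U = n := mul_left_cancel₀ hpi (by rw [hn]; ring)
  exact hU (-n) (by rw [this]; push_cast; ring)

/-- Poisson summation for a Gaussian with characteristics. -/
lemma gaussian_poisson {c : ℝ} (hc : 0 < c) (s β : ℝ) (U : ℂ) :
    c * ∑' n : ℤ, cexp (-π * c ^ 2 * (s + n - β) ^ 2 + 2 * π * I * (s + n) * U) =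
      ∑' b : ℤ, cexp (-2 * π * I * s * b + 2 * π * I * β * (U + b) - π * (U + b) ^ 2 / c ^ 2) := by
  have hc0 : (c : ℂ) ≠ 0 := by exact_mod_cast hc.ne'
  -- The right side is a theta series of modulus i/c². Inversion gives modulus ic², which is the
  -- Gaussian on the left.
  have key := jacobiTheta₂_functional_equation (-(s - β) + I * U / c ^ 2) (I / c ^ 2)
  have h1 : (1 : ℂ) / (-I * (I / c ^ 2)) ^ (1 / 2 : ℂ) = c := by
    have : (-I * (I / c ^ 2) : ℂ) = (((c ^ 2)⁻¹ : ℝ) : ℂ) := by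
      push_cast
      rw [← mul_div_assoc, neg_mul, I_mul_I, neg_neg, one_div]
    rw [this, show (1 / 2 : ℂ) = ((1 / 2 : ℝ) : ℂ) by push_cast; rfl,
      ← ofReal_cpow (by positivity), ← Real.sqrt_eq_rpow, Real.sqrt_inv, Real.sqrt_sq hc.le]
    simp
  rw [h1] at key
  have hb : ∑' b : ℤ, cexp (-2 * π * I * s * b + 2 * π * I * β * (U + b)
      - π * (U + b) ^ 2 / c ^ 2) = cexp (2 * π * I * β * U - π * U ^ 2 / c ^ 2) *
      jacobiTheta₂ (-(s - β) + I * U / c ^ 2) (I / c ^ 2) := by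
    rw [jacobiTheta₂, ← tsum_mul_left]
    refine tsum_congr fun b => ?_
    rw [jacobiTheta₂_term, ← Complex.exp_add]
    congr 1
    linear_combination (-2 * π * b * U / c ^ 2 - π * b ^ 2 / c ^ 2 : ℂ) * I_sq
  rw [hb, key, jacobiTheta₂, ← tsum_mul_left, ← tsum_mul_left, ← tsum_mul_left]
  refine tsum_congr fun n => ?_
  rw [jacobiTheta₂_term, mul_assoc (c : ℂ), mul_left_comm _ (c : ℂ), ← Complex.exp_add,
    ← Complex.exp_add]
  congr 2
  have hI : (1 : ℂ) / I = -I := by simp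
  have e1 : (-1 / (I / c ^ 2) : ℂ) = I * c ^ 2 := by
    field_simp; linear_combination -I_sq
  have e2 : ((-(s - β) + I * U / c ^ 2) / (I / c ^ 2) : ℂ) = I * c ^ 2 * (s - β) + U := by
    field_simp; linear_combination (-(c : ℂ) ^ 2 * (s - β)) * I_sq
  have e3 : (-π * I * (-(s - β) + I * U / c ^ 2) ^ 2 / (I / c ^ 2) : ℂ) =
      -π * c ^ 2 * (s - β) ^ 2 + 2 * π * I * (s - β) * U + π * U ^ 2 / c ^ 2 := by
    field_simp; linear_combination (-U ^ 2 : ℂ) * I_sq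
  rw [e1, e2, e3]
  linear_combination (-π * c ^ 2 * (2 * n * (s - β) + n ^ 2) : ℂ) * I_sq

/-! ### The error function -/

lemma hasDerivAt_errE (x : ℝ) : HasDerivAt errE (2 * Real.exp (-π * x ^ 2)) x := by
  have hc : Continuous fun u : ℝ => Real.exp (-π * u ^ 2) := by fun_prop
  exact (intervalIntegral.integral_hasDerivAt_right (hc.intervalIntegrable _ _)
    hc.stronglyMeasurable.stronglyMeasurableAtFilter hc.continuousAt).const_mul 2

lemma errE_neg (x : ℝ) : errE (-x) = -errE x := by
  have h := intervalIntegral.integral_comp_neg (a := 0) (b := x)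
    (fun u : ℝ => Real.exp (-π * u ^ 2))
  simp only [neg_sq, neg_zero] at h
  rw [errE, errE, h, intervalIntegral.integral_symm]
  ring

lemma one_sub_errE {x : ℝ} : 1 - errE x = 2 * ∫ u in Set.Ioi x, Real.exp (-π * u ^ 2) := by
  have hint : MeasureTheory.Integrable fun u : ℝ => Real.exp (-π * u ^ 2) :=
    integrable_exp_neg_mul_sq Real.pi_pos
  have h0 : ∫ u in Set.Ioi (0 : ℝ), Real.exp (-π * u ^ 2) = 1 / 2 := by
    rw [integral_gaussian_Ioi, div_self Real.pi_ne_zero, Real.sqrt_one]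
  have := intervalIntegral.integral_interval_add_Ioi (a := (0 : ℝ)) (b := x)
    hint.integrableOn hint.integrableOn
  rw [h0] at this
  rw [errE]
  linarith

lemma one_sub_errE_nonneg (x : ℝ) : 0 ≤ 1 - errE x := by
  rw [one_sub_errE]
  exact mul_nonneg zero_le_two (MeasureTheory.integral_nonneg fun u => (Real.exp_pos _).le)

/-- Shift the tail integral to (0, ∞) and use (u + x)² ≥ u² + x² for u, x ≥ 0. -/
lemma one_sub_errE_le {x : ℝ} (hx : 0 ≤ x) : 1 - errE x ≤ Real.exp (-π * x ^ 2) := by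
  have hint : MeasureTheory.Integrable fun u : ℝ => Real.exp (-π * u ^ 2) :=
    integrable_exp_neg_mul_sq Real.pi_pos
  have h0 : ∫ u in Set.Ioi (0 : ℝ), Real.exp (-π * u ^ 2) = 1 / 2 := by
    rw [integral_gaussian_Ioi, div_self Real.pi_ne_zero, Real.sqrt_one]
  have hshift : ∫ u in Set.Ioi x, Real.exp (-π * u ^ 2) =
      ∫ u in Set.Ioi (0 : ℝ), Real.exp (-π * (u + x) ^ 2) := by
    have := (MeasureTheory.measurePreserving_add_right MeasureTheory.volume x).setIntegral_preimage_emb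
      (MeasurableEquiv.addRight x).measurableEmbedding
      (fun u : ℝ => Real.exp (-π * u ^ 2)) (Set.Ioi x)
    simpa using this.symm
  have hle : ∫ u in Set.Ioi (0 : ℝ), Real.exp (-π * (u + x) ^ 2) ≤
      ∫ u in Set.Ioi (0 : ℝ), Real.exp (-π * x ^ 2) * Real.exp (-π * u ^ 2) := by
    refine MeasureTheory.setIntegral_mono_on (hint.comp_add_right x).integrableOn
      (hint.const_mul _).integrableOn measurableSet_Ioi fun u hu => ?_
    rw [← Real.exp_add]
    have : 0 ≤ π * (u * x) := mul_nonneg Real.pi_pos.le (mul_nonneg (le_of_lt hu) hx)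
    exact Real.exp_le_exp.mpr (by nlinarith)
  rw [MeasureTheory.integral_const_mul, h0] at hle
  rw [one_sub_errE, hshift]
  linarith

lemma abs_errE_le_one (x : ℝ) : |errE x| ≤ 1 := by
  have h1 := one_sub_errE_nonneg x
  have h2 := one_sub_errE_nonneg (-x)
  rw [errE_neg] at h2
  exact abs_le.mpr ⟨by linarith, by linarith⟩

/-- The coefficient `sgn (n + 1/2) - E (c (s + n - β))`. -/
noncomputable def errCoeff (c s β : ℝ) (n : ℤ) : ℝ :=
  Real.sign ((n : ℝ) + 1 / 2) - errE (c * (s + n - β))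

lemma sign_int_add_half_of_nonneg {n : ℤ} (hn : 0 ≤ n) : Real.sign ((n : ℝ) + 1 / 2) = 1 :=
  Real.sign_of_pos (by have : (0 : ℝ) ≤ n := by exact_mod_cast hn
                       linarith)

lemma sign_int_add_half_of_neg {n : ℤ} (hn : n < 0) : Real.sign ((n : ℝ) + 1 / 2) = -1 :=
  Real.sign_of_neg (by have : (n : ℝ) ≤ -1 := by exact_mod_cast Int.le_sub_one_of_lt hn
                       linarith)

/-- Where n + 1/2 and s + n - β have the same sign, the coefficient is a Gaussian tail. Elsewhere |s
+ n - β| ≤ |s - β|, and the constant in front absorbs the trivial bound 2. -/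
lemma abs_errCoeff_le {c : ℝ} (hc : 0 < c) (s β : ℝ) (n : ℤ) :
    |errCoeff c s β n| ≤
      2 * Real.exp (π * c ^ 2 * (s - β) ^ 2) * Real.exp (-π * c ^ 2 * (s + n - β) ^ 2) := by
  have hE1 : (1 : ℝ) ≤ Real.exp (π * c ^ 2 * (s - β) ^ 2) := Real.one_le_exp (by positivity)
  have hE2 := Real.exp_pos (-π * c ^ 2 * (s + n - β) ^ 2)
  have hsmall : ∀ {y : ℝ}, y ≤ Real.exp (-π * c ^ 2 * (s + n - β) ^ 2) →
      y ≤ 2 * Real.exp (π * c ^ 2 * (s - β) ^ 2) * Real.exp (-π * c ^ 2 * (s + n - β) ^ 2) :=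
    fun h => h.trans (le_mul_of_one_le_left hE2.le (by linarith))
  have hbig : (s + n - β) ^ 2 ≤ (s - β) ^ 2 →
      2 ≤ 2 * Real.exp (π * c ^ 2 * (s - β) ^ 2) * Real.exp (-π * c ^ 2 * (s + n - β) ^ 2) := by
    intro h
    rw [mul_assoc, ← Real.exp_add]
    refine le_mul_of_one_le_right zero_le_two (Real.one_le_exp ?_)
    have : 0 ≤ π * c ^ 2 * ((s - β) ^ 2 - (s + n - β) ^ 2) :=
      mul_nonneg (by positivity) (by linarith)
    linarith
  have htriv : ∀ {y : ℝ}, |y| ≤ 1 → |y - errE (c * (s + n - β))| ≤ 2 := fun {y} hy =>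
    (abs_sub _ _).trans (by linarith [abs_errE_le_one (c * (s + n - β))])
  rcases le_or_gt 0 n with hn | hn
  · have hn' : (0 : ℝ) ≤ n := by exact_mod_cast hn
    rw [errCoeff, sign_int_add_half_of_nonneg hn]
    rcases le_or_gt 0 (s + n - β) with hx | hx
    · refine hsmall ?_
      rw [abs_of_nonneg (one_sub_errE_nonneg _)]
      exact (one_sub_errE_le (by positivity)).trans (le_of_eq (by ring_nf))
    · exact (htriv (by simp)).trans (hbig (by nlinarith))
  · have hn' : (n : ℝ) < 0 := by exact_mod_cast hn
    rw [errCoeff, sign_int_add_half_of_neg hn]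
    rcases le_or_gt 0 (s + n - β) with hx | hx
    · exact (htriv (by simp)).trans (hbig (by nlinarith))
    · refine hsmall ?_
      have h1 := one_sub_errE_nonneg (-(c * (s + n - β)))
      have h2 := one_sub_errE_le (x := -(c * (s + n - β))) (by nlinarith)
      rw [errE_neg] at h1 h2
      rw [abs_of_nonpos (by linarith)]
      calc _ ≤ Real.exp (-π * (-(c * (s + n - β))) ^ 2) := by linarith
        _ = _ := by ring_nf

end

end N3

namespace N3

section

open Complex
open scoped Real

/-! ### The completed geometric series -/

lemma norm_exp_of_eq {w : ℂ} (x y : ℝ) (h : w = x + y * I) : ‖cexp w‖ = Real.exp x := by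
  rw [h, Complex.norm_exp]
  simp

lemma summable_exp_shifted_quadratic {a : ℝ} (ha : 0 < a) (b x y : ℝ) :
    Summable fun n : ℤ => Real.exp (-a * (x + n - y) ^ 2 + b * (x + n)) := by
  refine ((summable_exp_quadratic ha (b - 2 * a * (x - y))).mul_left
    (Real.exp (-a * (x - y) ^ 2 + b * x))).congr fun n => ?_
  rw [← Real.exp_add]
  ring_nf

lemma norm_exp_two_pi_I_mul (x : ℝ) (U : ℂ) :
    ‖cexp (2 * π * I * x * U)‖ = Real.exp (-2 * π * U.im * x) := by
  refine norm_exp_of_eq _ (2 * π * x * U.re) ?_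
  conv_lhs => rw [← re_add_im U]
  push_cast
  linear_combination (2 * π * x * U.im : ℂ) * I_sq

lemma summable_norm_errCoeff_mul_exp {c : ℝ} (hc : 0 < c) (s β : ℝ) (U : ℂ) :
    Summable fun n : ℤ => ‖(errCoeff c s β n : ℂ) * cexp (2 * π * I * (s + n) * U)‖ := by
  refine Summable.of_nonneg_of_le (fun n => norm_nonneg _) (fun n => ?_)
    ((summable_exp_shifted_quadratic (a := π * c ^ 2) (by positivity) (-2 * π * U.im) s β).mul_left
      (2 * Real.exp (π * c ^ 2 * (s - β) ^ 2)))
  have := norm_exp_two_pi_I_mul (s + n) U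
  push_cast at this
  rw [norm_mul, this, norm_real, Real.norm_eq_abs, Real.exp_add, ← mul_assoc]
  refine mul_le_mul_of_nonneg_right ?_ (Real.exp_pos _).le
  simpa using abs_errCoeff_le hc s β n

/-- The nonholomorphic series `∑ₙ (sgn (n + 1/2) - E (c (s + n - β))) exp (2πi(s + n)U)`. -/
noncomputable def errSeries (c s : ℝ) (U : ℂ) (β : ℝ) : ℂ :=
  ∑' n : ℤ, (errCoeff c s β n : ℂ) * cexp (2 * π * I * (s + n) * U)

/-- The term of the Gaussian-weighted series `∑_b exp (…) / (U + b)`. -/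
noncomputable def gaussPoleTerm (c s : ℝ) (U : ℂ) (β : ℝ) (b : ℤ) : ℂ :=
  cexp (-2 * π * I * s * b + 2 * π * I * β * (U + b) - π * (U + b) ^ 2 / c ^ 2) / (U + b)

/-- The sign is constant in β, so differentiating termwise leaves a pure Gaussian series.
Restricting β to a bounded interval gives a uniform majorant. -/
lemma hasDerivAt_errSeries {c : ℝ} (hc : 0 < c) (s : ℝ) (U : ℂ) (β : ℝ) :
    HasDerivAt (errSeries c s U)
      (2 * c * ∑' n : ℤ, cexp (-π * c ^ 2 * (s + n - β) ^ 2 + 2 * π * I * (s + n) * U)) β := by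
  have hterm : ∀ (n : ℤ) (y : ℝ), HasDerivAt
      (fun y : ℝ => (errCoeff c s y n : ℂ) * cexp (2 * π * I * (s + n) * U))
      (2 * c * cexp (-π * c ^ 2 * (s + n - y) ^ 2 + 2 * π * I * (s + n) * U)) y := by
    intro n y
    have h1 : HasDerivAt (fun y : ℝ => errCoeff c s y n)
        (-(2 * Real.exp (-π * (c * (s + n - y)) ^ 2) * (c * -1))) y :=
      ((hasDerivAt_errE _).comp y (((hasDerivAt_id y).const_sub (s + n)).const_mul c)).const_sub _
    refine (h1.ofReal_comp.mul_const (cexp (2 * π * I * (s + n) * U))).congr_deriv ?_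
    push_cast
    rw [Complex.exp_add]
    ring_nf
  set B : ℝ := |β| + 1
  have hmem : β ∈ Set.Ioo (-B) B := by
    constructor <;> simp only [B] <;> linarith [neg_abs_le β, le_abs_self β]
  have hbound : ∀ (n : ℤ) (y : ℝ), y ∈ Set.Ioo (-B) B →
      ‖2 * c * cexp (-π * c ^ 2 * (s + n - y) ^ 2 + 2 * π * I * (s + n) * U)‖ ≤
      2 * c * Real.exp (π * c ^ 2 * (|s| + B) ^ 2 - 2 * π * U.im * s) *
        Real.exp (-(π * c ^ 2 / 2) * n ^ 2 + (-2 * π * U.im) * n) := by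
    intro n y hy
    have h1 : ‖cexp (-π * c ^ 2 * (s + n - y) ^ 2 + 2 * π * I * (s + n) * U)‖ =
        Real.exp (-π * c ^ 2 * (s + n - y) ^ 2 - 2 * π * U.im * (s + n)) := by
      refine norm_exp_of_eq _ (2 * π * (s + n) * U.re) ?_
      conv_lhs => rw [← re_add_im U]
      push_cast
      linear_combination (2 * π * (s + n) * U.im : ℂ) * I_sq
    have h2 : (s - y) ^ 2 ≤ (|s| + B) ^ 2 := by
      refine sq_le_sq' ?_ ?_ <;> linarith [neg_abs_le s, le_abs_self s, hy.1, hy.2]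
    -- Write n = (s + n - y) - (s - y) and use (A - B)² ≤ 2A² + 2B².
    have h3 : (n : ℝ) ^ 2 / 2 ≤ (s + n - y) ^ 2 + (|s| + B) ^ 2 := by
      nlinarith [sq_nonneg ((s + n - y) + (s - y))]
    rw [norm_mul, h1, norm_mul, norm_real, Real.norm_of_nonneg hc.le, RCLike.norm_ofNat,
      mul_assoc (2 * c), ← Real.exp_add]
    refine mul_le_mul_of_nonneg_left (Real.exp_le_exp.mpr ?_) (by positivity)
    have := mul_le_mul_of_nonneg_left h3 (show 0 ≤ π * c ^ 2 by positivity)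
    linarith
  rw [← tsum_mul_left]
  exact hasDerivAt_tsum_of_isPreconnected
    ((summable_exp_quadratic (a := π * c ^ 2 / 2) (by positivity) (-2 * π * U.im)).mul_left _)
    isOpen_Ioo isPreconnected_Ioo (fun n y _ => hterm n y) hbound hmem
    (summable_norm_errCoeff_mul_exp hc s β U).of_norm hmem

lemma norm_exp_gaussPole {c : ℝ} (s : ℝ) (U : ℂ) (β : ℝ) (b : ℤ) :
    ‖cexp (-2 * π * I * s * b + 2 * π * I * β * (U + b) - π * (U + b) ^ 2 / c ^ 2)‖ =
      Real.exp (-2 * π * β * U.im + π * U.im ^ 2 / c ^ 2) *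
        Real.exp (-(π / c ^ 2) * (U.re + b - 0) ^ 2 + 0 * (U.re + b)) := by
  rw [← Real.exp_add]
  refine norm_exp_of_eq _
    (-2 * π * s * b + 2 * π * β * (U.re + b) - 2 * π * (U.re + b) * U.im / c ^ 2) ?_
  conv_lhs => rw [← re_add_im U]
  push_cast
  linear_combination (2 * π * β * U.im - π * U.im ^ 2 / c ^ 2 : ℂ) * I_sq

lemma eventually_one_le_norm_add_int (U : ℂ) :
    ∀ᶠ b : ℤ in Filter.cofinite, 1 ≤ ‖U + b‖ := by
  have h : Filter.Tendsto (fun b : ℤ => ‖((b : ℝ) : ℂ)‖) Filter.cofinite Filter.atTop := by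
    simpa using! (tendsto_norm_cocompact_atTop (E := ℝ)).comp Int.tendsto_coe_cofinite
  filter_upwards [h.eventually_ge_atTop (1 + ‖U‖)] with b hb
  have := norm_sub_norm_le ((b : ℝ) : ℂ) (-U)
  rw [norm_neg, sub_neg_eq_add, add_comm _ U] at this
  push_cast at this hb
  linarith

lemma summable_gaussPoleTerm {c : ℝ} (hc : 0 < c) (s : ℝ) (U : ℂ) (β : ℝ) :
    Summable (gaussPoleTerm c s U β) := by
  refine Summable.of_norm_bounded_eventually
    ((summable_exp_shifted_quadratic (a := π / c ^ 2) (by positivity) 0 U.re 0).mul_left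
      (Real.exp (-2 * π * β * U.im + π * U.im ^ 2 / c ^ 2))) ?_
  filter_upwards [eventually_one_le_norm_add_int U] with b hb
  rw [gaussPoleTerm, norm_div, norm_exp_gaussPole]
  exact div_le_self (by positivity) hb

lemma hasDerivAt_tsum_gaussPoleTerm {c : ℝ} (hc : 0 < c) (s : ℝ) {U : ℂ}
    (hU : ∀ b : ℤ, U + b ≠ 0) (β : ℝ) :
    HasDerivAt (fun β => ∑' b : ℤ, gaussPoleTerm c s U β b)
      (2 * π * I * ∑' b : ℤ,
        cexp (-2 * π * I * s * b + 2 * π * I * β * (U + b) - π * (U + b) ^ 2 / c ^ 2)) β := by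
  have hterm : ∀ (b : ℤ) (y : ℝ), HasDerivAt (fun y : ℝ => gaussPoleTerm c s U y b)
      (2 * π * I *
        cexp (-2 * π * I * s * b + 2 * π * I * y * (U + b) - π * (U + b) ^ 2 / c ^ 2)) y := by
    intro b y
    have h0 : HasDerivAt (fun y : ℝ => -2 * π * I * s * b + 2 * π * I * (y : ℂ) * (U + b)
        - π * (U + b) ^ 2 / c ^ 2) (2 * π * I * 1 * (U + b)) y :=
      (((((hasDerivAt_id y).ofReal_comp).const_mul (2 * π * I)).mul_const _).const_add _).sub_const _
    refine (h0.cexp.div_const (U + b)).congr_deriv ?_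
    have := hU b
    field_simp
  set B : ℝ := |β| + 1
  have hmem : β ∈ Set.Ioo (-B) B := by
    constructor <;> simp only [B] <;> linarith [neg_abs_le β, le_abs_self β]
  have hbound : ∀ (b : ℤ) (y : ℝ), y ∈ Set.Ioo (-B) B →
      ‖2 * π * I *
        cexp (-2 * π * I * s * b + 2 * π * I * y * (U + b) - π * (U + b) ^ 2 / c ^ 2)‖ ≤
      2 * π * Real.exp (2 * π * (B * |U.im|) + π * U.im ^ 2 / c ^ 2) *
        Real.exp (-(π / c ^ 2) * (U.re + b - 0) ^ 2 + 0 * (U.re + b)) := by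
    intro b y hy
    have h1 : -(y * U.im) ≤ B * |U.im| := by
      refine (neg_le_abs _).trans ?_
      rw [abs_mul]
      exact mul_le_mul_of_nonneg_right (abs_le.mpr ⟨hy.1.le, hy.2.le⟩) (abs_nonneg _)
    have h2 : ‖(2 * π * I : ℂ)‖ = 2 * π := by
      simp [abs_of_pos Real.pi_pos]
    rw [norm_mul, norm_exp_gaussPole, h2, ← mul_assoc]
    refine mul_le_mul_of_nonneg_right (mul_le_mul_of_nonneg_left
      (Real.exp_le_exp.mpr ?_) (by positivity)) (Real.exp_pos _).le
    have := mul_le_mul_of_nonneg_left h1 (show 0 ≤ 2 * π by positivity)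
    linarith
  rw [← tsum_mul_left]
  exact hasDerivAt_tsum_of_isPreconnected
    ((summable_exp_shifted_quadratic (a := π / c ^ 2) (by positivity) 0 U.re 0).mul_left _)
    isOpen_Ioo isPreconnected_Ioo (fun n y _ => hterm n y) hbound hmem
    (summable_gaussPoleTerm hc s U β) hmem

/-- The shift multiplies each term by exp(2πi(U + b)), and exp(2πib) = 1. -/
lemma tsum_gaussPoleTerm_add_one (c s : ℝ) (U : ℂ) (β : ℝ) :
    ∑' b : ℤ, gaussPoleTerm c s U (β + 1) b =
      cexp (2 * π * I * U) * ∑' b : ℤ, gaussPoleTerm c s U β b := by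
  rw [← tsum_mul_left]
  refine tsum_congr fun b => ?_
  rw [gaussPoleTerm, gaussPoleTerm, ← mul_div_assoc, ← Complex.exp_add]
  congr 1
  rw [Complex.exp_eq_exp_iff_exists_int]
  exact ⟨b, by push_cast; ring⟩

lemma sign_int_sub_half (n : ℤ) : Real.sign ((n : ℝ) - 1 / 2) =
    Real.sign ((n : ℝ) + 1 / 2) - if n = 0 then 2 else 0 := by
  have h : (n : ℝ) - 1 / 2 = ((n - 1 : ℤ) : ℝ) + 1 / 2 := by push_cast; ring
  rw [h]
  rcases lt_trichotomy n 0 with hn | hn | hn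
  · rw [sign_int_add_half_of_neg hn, sign_int_add_half_of_neg (by lia), if_neg hn.ne, sub_zero]
  · rw [sign_int_add_half_of_nonneg hn.ge, sign_int_add_half_of_neg (by lia), if_pos hn]
    norm_num
  · rw [sign_int_add_half_of_nonneg hn.le, sign_int_add_half_of_nonneg (by lia), if_neg hn.ne',
      sub_zero]

/-- Shifting n along with β fixes the argument of E. Only the sign changes, at a single index, and
this produces the inhomogeneous term. With q = exp(2πiU), that term matches q^s/(1 - q) - q^s =
q·q^s/(1 - q) for the geometric series. -/
lemma errSeries_add_one {c : ℝ} (hc : 0 < c) (s : ℝ) (U : ℂ) (β : ℝ) :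
    errSeries c s U (β + 1) =
      cexp (2 * π * I * U) * errSeries c s U β + 2 * cexp (2 * π * I * s * U) := by
  rw [errSeries, ← (Equiv.addRight (1 : ℤ)).tsum_eq, errSeries, ← tsum_mul_left]
  have h1 : ∀ n : ℤ, (errCoeff c s (β + 1) (Equiv.addRight 1 n) : ℂ) *
      cexp (2 * π * I * (s + ((Equiv.addRight 1 n : ℤ) : ℂ)) * U) =
      cexp (2 * π * I * U) * ((errCoeff c s β n : ℂ) * cexp (2 * π * I * (s + n) * U)) +
        if n = -1 then 2 * cexp (2 * π * I * s * U) else 0 := by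
    intro n
    have hcoeff : errCoeff c s (β + 1) (n + 1) = errCoeff c s β n + if n = -1 then 2 else 0 := by
      have := sign_int_sub_half (n + 1)
      rw [errCoeff, errCoeff]
      push_cast at this ⊢
      rw [show (n : ℝ) + 1 - 1 / 2 = n + 1 / 2 by ring] at this
      rw [this, show s + ((n : ℝ) + 1) - (β + 1) = s + n - β by ring]
      have : n + 1 = 0 ↔ n = -1 := by lia
      simp only [this]
      ring
    rw [Equiv.coe_addRight, hcoeff]
    have hexp : cexp (2 * π * I * (s + ((n + 1 : ℤ) : ℂ)) * U) =
        cexp (2 * π * I * U) * cexp (2 * π * I * (s + n) * U) := by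
      rw [← Complex.exp_add]
      push_cast
      ring_nf
    by_cases hn : n = -1
    · subst hn
      rw [hexp]
      simp only [if_true]
      have : cexp (2 * π * I * U) * cexp (2 * π * I * (s + ((-1 : ℤ) : ℂ)) * U) =
          cexp (2 * π * I * s * U) := by
        rw [← Complex.exp_add]
        push_cast
        ring_nf
      push_cast at this ⊢
      linear_combination 2 * this
    · rw [hexp]
      simp only [if_neg hn]
      push_cast
      ring
  simp_rw [h1]
  rw [Summable.tsum_add]
  · rw [tsum_ite_eq]
  · exact (summable_norm_errCoeff_mul_exp hc s β U).of_norm.mul_left _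
  · exact (hasSum_ite_eq _ _).summable

/-- The completed geometric series as a Gaussian-weighted sum over its poles. -/
theorem geometric_sub_errSeries {c : ℝ} (hc : 0 < c) (s : ℝ) {U : ℂ}
    (hU : ∀ b : ℤ, U + b ≠ 0) (β : ℝ) :
    cexp (2 * π * I * s * U) / (1 - cexp (2 * π * I * U)) - 1 / 2 * errSeries c s U β =
      -(1 / (2 * π * I)) * ∑' b : ℤ, gaussPoleTerm c s U β b := by
  set D : ℝ → ℂ := fun β =>
    cexp (2 * π * I * s * U) / (1 - cexp (2 * π * I * U)) - 1 / 2 * errSeries c s U β -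
      -(1 / (2 * π * I)) * ∑' b : ℤ, gaussPoleTerm c s U β b with hD
  have hpi : (2 * π * I : ℂ) ≠ 0 := by simp [Real.pi_ne_zero]
  have hq := exp_ne_one_of_add_int_ne_zero hU
  -- Poisson summation identifies the two derivative series, so D is constant.
  have hderiv : ∀ β, HasDerivAt D 0 β := by
    intro β
    have h := (((hasDerivAt_errSeries hc s U β).const_mul (1 / 2)).const_sub
      (cexp (2 * π * I * s * U) / (1 - cexp (2 * π * I * U)))).sub
      ((hasDerivAt_tsum_gaussPoleTerm hc s hU β).const_mul (-(1 / (2 * π * I))))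
    refine h.congr_deriv ?_
    rw [← gaussian_poisson hc]
    generalize (∑' n : ℤ, cexp _) = S
    field_simp
    ring
  have hconst : D (β + 1) = D β :=
    is_const_of_deriv_eq_zero (fun x => (hderiv x).differentiableAt)
      (fun x => (hderiv x).deriv) _ _
  -- A constant that is also multiplied by exp(2πiU) ≠ 1 must vanish.
  have hper : D (β + 1) = cexp (2 * π * I * U) * D β := by
    simp only [hD]
    rw [tsum_gaussPoleTerm_add_one, errSeries_add_one hc]
    have : 1 - cexp (2 * π * I * U) ≠ 0 := sub_ne_zero.mpr hq.symm
    field_simp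
    ring
  have h0 : (1 - cexp (2 * π * I * U)) * D β = 0 := by
    linear_combination hper - hconst
  exact sub_eq_zero.mp ((mul_eq_zero.mp h0).resolve_left (sub_ne_zero.mpr hq.symm))

end

end N3

namespace N3

section

open Complex
open scoped Real

/-! ### Modified Appell functions as sums over the period lattice -/

lemma tsum_int_eq_sum_tsum_residues {f : ℤ → ℂ} (hf : Summable f) {M : ℕ} (hM : 0 < M) :
    ∑' n : ℤ, f n = ∑ r ∈ Finset.range M, ∑' l : ℤ, f (r + M * l) := by
  have : NeZero M := ⟨hM.ne'⟩
  have hs : Summable fun p : Fin M × ℤ => f (p.2 * M + p.1) := by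
    have := ((Equiv.prodComm _ _).trans (Int.divModEquiv M).symm).summable_iff.mpr hf
    refine this.congr fun p => ?_
    simp [Int.divModEquiv]
  rw [← ((Equiv.prodComm _ _).trans (Int.divModEquiv M).symm).tsum_eq]
  calc _ = ∑' p : Fin M × ℤ, f (p.2 * M + p.1) := by
        refine tsum_congr fun p => ?_
        simp [Int.divModEquiv]
    _ = ∑ r : Fin M, ∑' l : ℤ, f (l * M + r) := by rw [hs.tsum_prod, tsum_fintype]
    _ = _ := by
        rw [← Fin.sum_univ_eq_sum_range (fun r => ∑' l : ℤ, f (r + M * l))]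
        refine Finset.sum_congr rfl fun r _ => tsum_congr fun l => ?_
        rw [mul_comm, add_comm]

lemma summable_norm_thetaKM (k : ℝ) {m : ℝ} (hm : 0 < m) {τ : ℂ} (hτ : 0 < τ.im) (z : ℂ) :
    Summable fun j : ℤ => ‖cexp (2 * π * I * m * (j + k / (2 * m)) * z
      + 2 * π * I * τ * (m * (j + k / (2 * m)) ^ 2))‖ := by
  refine (summable_exp_shifted_quadratic (a := 2 * π * τ.im * m) (by positivity)
    (-2 * π * m * z.im) (k / (2 * m)) 0).congr fun j => ?_
  symm
  refine norm_exp_of_eq _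
    (2 * π * m * (j + k / (2 * m)) * z.re + 2 * π * τ.re * (m * (j + k / (2 * m)) ^ 2)) ?_
  conv_lhs => rw [← re_add_im z, ← re_add_im τ]
  push_cast
  linear_combination (2 * π * m * (j + k / (2 * m)) * z.im +
    2 * π * τ.im * (m * (j + k / (2 * m)) ^ 2) : ℂ) * I_sq

/-- The term of `R_{j;m}` with index `n = s + N`. -/
noncomputable def zwegersTerm (m s : ℝ) (τ w : ℂ) (n : ℤ) : ℂ :=
  (errCoeff √(τ.im / m) s (2 * m * (w.im / τ.im)) n : ℂ) *
    cexp (-(π * I * (s + n) ^ 2 * τ) / (2 * m) + 2 * π * I * (s + n) * w)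

/-- The exponential grows like exp(πn² Im τ/(2m)), while the coefficient decays like exp(-πn² Im
τ/m), so half of the decay survives. -/
lemma summable_norm_zwegersTerm {m : ℝ} (hm : 0 < m) (s : ℝ) {τ : ℂ} (hτ : 0 < τ.im) (w : ℂ) :
    Summable fun n : ℤ => ‖zwegersTerm m s τ w n‖ := by
  set β := 2 * m * (w.im / τ.im) with hβ
  have hc : 0 < √(τ.im / m) := Real.sqrt_pos.mpr (by positivity)
  have hc2 : √(τ.im / m) ^ 2 = τ.im / m := Real.sq_sqrt (by positivity)
  refine Summable.of_nonneg_of_le (fun n => norm_nonneg _) (fun n => ?_)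
    ((summable_exp_shifted_quadratic (a := π * τ.im / (2 * m)) (by positivity)
      (2 * π * (τ.im / m) * β - 2 * π * w.im) s 0).mul_left
      (2 * Real.exp (π * (τ.im / m) * (s - β) ^ 2 - π * (τ.im / m) * β ^ 2)))
  have h1 : ‖cexp (-(π * I * (s + n) ^ 2 * τ) / (2 * m) + 2 * π * I * (s + n) * w)‖ =
      Real.exp (π * (s + n) ^ 2 * τ.im / (2 * m) - 2 * π * (s + n) * w.im) := by
    refine norm_exp_of_eq _ (-(π * (s + n) ^ 2 * τ.re / (2 * m)) + 2 * π * (s + n) * w.re) ?_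
    conv_lhs => rw [← re_add_im τ, ← re_add_im w]
    push_cast
    linear_combination (-(π * (s + n) ^ 2 * τ.im / (2 * m)) + 2 * π * (s + n) * w.im : ℂ) * I_sq
  have h2 := abs_errCoeff_le hc s β n
  rw [hc2] at h2
  rw [zwegersTerm, norm_mul, norm_real, Real.norm_eq_abs, h1]
  refine (mul_le_mul_of_nonneg_right h2 (Real.exp_pos _).le).trans (le_of_eq ?_)
  simp only [mul_assoc (2 : ℝ) (Real.exp _), ← Real.exp_add]
  congr 2
  field_simp
  ring

/-- Since 0 ≤ r < M, both signs are decided by whether l ≥ 0. The signs of all residue classes thus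
come from the single index r + Ml, and the classes reassemble into one series. -/
lemma sign_shifted (r : ℕ) (l : ℤ) (M : ℕ) (hr : r < M) :
    Real.sign (((M * l : ℤ) : ℝ) - 1 / 2 + M) = Real.sign (((r + M * l : ℤ) : ℝ) + 1 / 2) := by
  have h : (((M * l : ℤ) : ℝ) - 1 / 2 + M) = ((M * (l + 1) - 1 : ℤ) : ℝ) + 1 / 2 := by
    push_cast; ring
  rw [h]
  rcases le_or_gt 0 l with hl | hl
  · rw [sign_int_add_half_of_nonneg (by nlinarith), sign_int_add_half_of_nonneg (by positivity)]
  · rw [sign_int_add_half_of_neg (by nlinarith), sign_int_add_half_of_neg (by nlinarith)]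

lemma zwegersR_eq_tsum {m : ℝ} {M : ℕ} (hM : 2 * m = M) (s : ℝ) (τ w : ℂ) {r : ℕ} (hr : r < M) :
    zwegersR (s + r) m τ w = ∑' l : ℤ, zwegersTerm m s τ w (r + M * l) := by
  have hk : ∀ l : ℤ, s + r + 2 * m * l = s + ((r + M * l : ℤ) : ℝ) := fun l => by
    push_cast
    rw [← hM]
    ring
  have hsgn : ∀ l : ℤ, s + ((r + M * l : ℤ) : ℝ) - 1 / 2 - (s + r) + 2 * m =
      ((M * l : ℤ) : ℝ) - 1 / 2 + M := fun l => by
    push_cast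
    rw [← hM]
    ring
  refine tsum_congr fun l => ?_
  rw [hk, hsgn, sign_shifted r l M hr, zwegersTerm, errCoeff, mul_comm √(τ.im / m), ofReal_add,
    ofReal_intCast]

/-- The modified Appell function `Φ₁ - ½ ∑ R θ` at `t = 0`. -/
noncomputable def modifiedAppell (M : ℕ) (m s : ℝ) (τ z₁ z₂ : ℂ) : ℂ :=
  Phi1 m s τ z₁ z₂ 0 - 1 / 2 * ∑ r ∈ Finset.range M,
    zwegersR (s + r) m τ ((z₁ - z₂) / 2) * thetaKM (s + r) m τ (z₁ + z₂)

lemma thetaKM_neg_left (k m : ℝ) (τ z : ℂ) : thetaKM (-k) m τ z = thetaKM k m τ (-z) := by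
  rw [thetaKM, ← (Equiv.neg ℤ).tsum_eq, thetaKM]
  refine tsum_congr fun j => ?_
  congr 1
  simp only [Equiv.neg_apply]
  push_cast
  ring

lemma Phi2_eq_Phi1 (m s : ℝ) (τ z₁ z₂ t : ℂ) : Phi2 m s τ z₁ z₂ t = Phi1 m s τ (-z₂) (-z₁) t := by
  rw [Phi2, Phi1]
  congr 1
  refine tsum_congr fun j => ?_
  congr 2 <;> ring_nf

lemma Phi1_eq_mul (m s : ℝ) (τ z₁ z₂ t : ℂ) :
    Phi1 m s τ z₁ z₂ t = cexp (-2 * π * I * m * t) * Phi1 m s τ z₁ z₂ 0 := by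
  simp [Phi1]

/-- The substitution (z₁, z₂) ↦ (-z₂, -z₁) turns Φ₁ into Φ₂. It fixes z₁ - z₂, hence R, and negates
z₁ + z₂, hence turns θ_k into θ_{-k}. -/
lemma PhiTilde_eq_modifiedAppell {m : ℝ} {M : ℕ} (hM : 2 * m = M) (s : ℝ) (τ z₁ z₂ t : ℂ) :
    PhiTilde m s τ z₁ z₂ t = cexp (-2 * π * I * m * t) *
      (modifiedAppell M m s τ z₁ z₂ - modifiedAppell M m s τ (-z₂) (-z₁)) := by
  have hceil : ⌈2 * m⌉₊ = M := by rw [hM, Nat.ceil_natCast]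
  rw [PhiTilde, Phi, PhiAdd, Phi2_eq_Phi1, Phi1_eq_mul, Phi1_eq_mul m s τ (-z₂), hceil,
    modifiedAppell, modifiedAppell]
  have hw : (-z₂ - -z₁) / 2 = (z₁ - z₂) / 2 := by ring
  have hz : -z₂ + -z₁ = -(z₁ + z₂) := by ring
  simp only [hw, hz, thetaKM_neg_left, mul_sub, Finset.sum_sub_distrib]
  ring

/-- The exponent of the term `(j, b)` of the modified Appell function as a sum over the lattice. -/
noncomputable def appellExponent (m s : ℝ) (τ z₁ z₂ : ℂ) (j b : ℤ) : ℂ :=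
  2 * π * I * m * j * (z₁ + z₂) + 2 * π * I * τ * (m * j ^ 2) +
    (-2 * π * I * s * b + 2 * π * I * ((2 * m * (((z₁ - z₂) / 2).im / τ.im) : ℝ) : ℂ) *
      (z₁ + τ * j + b) - π * (z₁ + τ * j + b) ^ 2 / ((τ.im / m : ℝ) : ℂ))

/-- The summand of `R θ` rearranged over the elliptic variable. -/
noncomputable def correctionTerm (m s : ℝ) (τ z₁ z₂ : ℂ) (j n : ℤ) : ℂ :=
  cexp (2 * π * I * m * j * (z₁ + z₂) + 2 * π * I * τ * (m * j ^ 2)) *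
    ((errCoeff √(τ.im / m) s (2 * m * (((z₁ - z₂) / 2).im / τ.im)) n : ℂ) *
      cexp (2 * π * I * (s + n) * (z₁ + τ * j)))

/-- With theta index j + l, its argument is j + n/(2m), where n = s + r + Ml is the index in R. The
n² terms then cancel, and the exponent is linear in n with coefficient 2πi(z₁ + τj). -/
lemma zwegersTerm_mul_theta {m : ℝ} (hm : 0 < m) {M : ℕ} (hM : 2 * m = M) (s : ℝ)
    (τ z₁ z₂ : ℂ) (r : ℕ) (l j : ℤ) :
    zwegersTerm m s τ ((z₁ - z₂) / 2) (r + M * l) *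
      cexp (2 * π * I * m * (((j + l : ℤ) : ℂ) + ((s + r : ℝ) : ℂ) / (2 * m)) * (z₁ + z₂)
      + 2 * π * I * τ * (m * (((j + l : ℤ) : ℂ) + ((s + r : ℝ) : ℂ) / (2 * m)) ^ 2)) =
    correctionTerm m s τ z₁ z₂ j (r + M * l) := by
  have hm0 : (m : ℂ) ≠ 0 := by exact_mod_cast hm.ne'
  have hM' : (M : ℂ) = 2 * m := by exact_mod_cast hM.symm
  rw [zwegersTerm, correctionTerm, mul_assoc, mul_left_comm (cexp _), ← Complex.exp_add,
    ← Complex.exp_add]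
  congr 2
  push_cast
  rw [hM']
  field_simp
  ring

lemma hasSum_correctionTerm {m : ℝ} (hm : 0 < m) {M : ℕ} (hM : 2 * m = M) (s : ℝ)
    {τ : ℂ} (hτ : 0 < τ.im) (z₁ z₂ : ℂ) {r : ℕ} (hr : r < M) :
    HasSum (fun p : ℤ × ℤ => correctionTerm m s τ z₁ z₂ p.1 (r + M * p.2))
      (zwegersR (s + r) m τ ((z₁ - z₂) / 2) * thetaKM (s + r) m τ (z₁ + z₂)) := by
  have hM0 : 0 < M := by lia
  have hinj : Function.Injective fun l : ℤ => (r + M * l : ℤ) := fun a b h => by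
    have hMz : (M : ℤ) ≠ 0 := by exact_mod_cast hM0.ne'
    exact mul_left_cancel₀ hMz (add_left_cancel h)
  have h1 := (summable_norm_zwegersTerm hm s hτ ((z₁ - z₂) / 2)).comp_injective hinj
  have h2 := summable_norm_thetaKM (s + r) hm hτ (z₁ + z₂)
  rw [zwegersR_eq_tsum hM s τ _ hr, thetaKM, tsum_mul_tsum_of_summable_norm h1 h2]
  have hs := (summable_mul_of_summable_norm h1 h2).hasSum
  -- The pair (j, l) corresponds to the index l in R and j + l in θ.
  let e : ℤ × ℤ ≃ ℤ × ℤ :=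
    { toFun := fun p => (p.2, p.1 + p.2)
      invFun := fun p => (p.2 - p.1, p.1)
      left_inv := fun p => by simp
      right_inv := fun p => by simp }
  refine (e.hasSum_iff.mpr hs).congr_fun fun p => ?_
  exact (zwegersTerm_mul_theta hm hM s τ z₁ z₂ r p.2 p.1).symm

/-- The modified Appell function as a sum over the period lattice. -/
theorem modifiedAppell_eq_tsum {m : ℝ} (hm : 0 < m) {M : ℕ} (hM : 2 * m = M) (s : ℝ)
    {τ : ℂ} (hτ : 0 < τ.im) (z₁ z₂ : ℂ) (hz : ∀ j b : ℤ, z₁ + τ * j + b ≠ 0)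
    (hs : Summable fun p : ℤ × ℤ =>
      cexp (appellExponent m s τ z₁ z₂ p.1 p.2) / (z₁ + τ * p.1 + p.2)) :
    modifiedAppell M m s τ z₁ z₂ = -(1 / (2 * π * I)) * ∑' p : ℤ × ℤ,
      cexp (appellExponent m s τ z₁ z₂ p.1 p.2) / (z₁ + τ * p.1 + p.2) := by
  have hM0 : 0 < M := by
    have : (0 : ℝ) < M := by rw [← hM]; positivity
    exact_mod_cast this
  set β := 2 * m * (((z₁ - z₂) / 2).im / τ.im) with hβ
  have hc : 0 < √(τ.im / m) := Real.sqrt_pos.mpr (by positivity)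
  have hc2 : ((√(τ.im / m) : ℝ) : ℂ) ^ 2 = ((τ.im / m : ℝ) : ℂ) := by
    rw [← ofReal_pow, Real.sq_sqrt (by positivity)]
  set P : ℤ → ℂ := fun j => cexp (2 * π * I * m * j * (z₁ + z₂) + 2 * π * I * τ * (m * j ^ 2))
    with hP
  -- For fixed j the correction terms form the error series at U = z₁ + τj. Summing over j and
  -- splitting n by residues modulo M = 2m recovers ∑ Rθ.
  have hcorr : ∀ j, HasSum (fun n => correctionTerm m s τ z₁ z₂ j n)
      (P j * errSeries √(τ.im / m) s (z₁ + τ * j) β) := fun j =>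
    ((summable_norm_errCoeff_mul_exp hc s β (z₁ + τ * j)).of_norm.hasSum).mul_left _
  have hRθ : HasSum (fun j => P j * errSeries √(τ.im / m) s (z₁ + τ * j) β)
      (∑ r ∈ Finset.range M,
        zwegersR (s + r) m τ ((z₁ - z₂) / 2) * thetaKM (s + r) m τ (z₁ + z₂)) := by
    have h := hasSum_sum fun r (hr : r ∈ Finset.range M) =>
      (hasSum_correctionTerm hm hM s hτ z₁ z₂ (Finset.mem_range.mp hr)).prod_fiberwise fun j =>
        ((hasSum_correctionTerm hm hM s hτ z₁ z₂ (Finset.mem_range.mp hr)).summable.prod_factor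
          j).hasSum
    refine h.congr_fun fun j => ?_
    rw [← (hcorr j).tsum_eq, tsum_int_eq_sum_tsum_residues (hcorr j).summable hM0]
  have hgauss : HasSum (fun j : ℤ => P j * ∑' b : ℤ,
      gaussPoleTerm √(τ.im / m) s (z₁ + τ * j) β b) (∑' p : ℤ × ℤ,
      cexp (appellExponent m s τ z₁ z₂ p.1 p.2) / (z₁ + τ * p.1 + p.2)) := by
    refine (hs.hasSum.prod_fiberwise fun j => (hs.prod_factor j).hasSum).congr_fun fun j => ?_
    rw [← tsum_mul_left]
    refine tsum_congr fun b => ?_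
    rw [gaussPoleTerm, ← mul_div_assoc, ← Complex.exp_add, hc2, appellExponent]
  -- Each term of Φ₁ is P j times a geometric series at U = z₁ + τj. Its completion leaves an error
  -- series, whose sum over j is the subtracted correction.
  have hterm : ∀ j : ℤ, cexp (2 * π * I * m * j * (z₁ + z₂) + 2 * π * I * s * z₁
      + 2 * π * I * τ * (m * j ^ 2 + s * j)) / (1 - cexp (2 * π * I * z₁ + 2 * π * I * τ * j)) =
      -(1 / (2 * π * I)) * (P j * ∑' b : ℤ, gaussPoleTerm √(τ.im / m) s (z₁ + τ * j) β b) +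
        1 / 2 * (P j * errSeries √(τ.im / m) s (z₁ + τ * j) β) := by
    intro j
    have h := geometric_sub_errSeries hc s (U := z₁ + τ * j) (fun b => hz j b) β
    have h1 : cexp (2 * π * I * m * j * (z₁ + z₂) + 2 * π * I * s * z₁
      + 2 * π * I * τ * (m * j ^ 2 + s * j)) = P j * cexp (2 * π * I * s * (z₁ + τ * j)) := by
      rw [hP, ← Complex.exp_add]
      ring_nf
    have h2 : 2 * π * I * z₁ + 2 * π * I * τ * j = 2 * π * I * (z₁ + τ * j) := by ring
    rw [h1, h2, mul_div_assoc]
    linear_combination P j * h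
  have hA := ((hgauss.mul_left (-(1 / (2 * π * I : ℂ)))).add (hRθ.mul_left (1 / 2))).congr_fun hterm
  rw [modifiedAppell, Phi1, hA.tsum_eq]
  simp

end

end N3

namespace N3

section

open Complex
open scoped Real ComplexConjugate

/-! ### Lattice sums of Gaussian kernels and the action of T and S -/

/-- The half period `(aτ + c) / 2`. -/
noncomputable def halfPeriod (τ : ℂ) (p : ℤ × ℤ) : ℂ := (p.1 * τ + p.2) / 2

/-- The Gaussian pole kernel at the half period `ν = (aτ + c) / 2`. -/
noncomputable def latticeKernel (M : ℕ) (τ z : ℂ) (p : ℤ × ℤ) : ℂ :=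
  cexp (-(π * M / (4 * τ.im)) * (z ^ 2 + halfPeriod τ p * conj (halfPeriod τ p)
    + 2 * conj (halfPeriod τ p) * z)) / (z + halfPeriod τ p)

/-- The lattice sum of Gaussian pole kernels with weights `φ`. -/
noncomputable def latticeSum (M : ℕ) (φ : ℤ × ℤ → ℂ) (τ z : ℂ) : ℂ :=
  ∑' p : ℤ × ℤ, φ p * latticeKernel M τ z p

lemma exists_norm_halfPeriod_ge {τ : ℂ} (hτ : 0 < τ.im) :
    ∃ κ : ℝ, 0 < κ ∧ ∀ p : ℤ × ℤ, κ * ((p.1 : ℝ) ^ 2 + (p.2 : ℝ) ^ 2) ≤ ‖halfPeriod τ p‖ ^ 2 := by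
  set T : ℍ := ⟨τ, hτ⟩
  -- The 8 combines a factor 4 from the halved period with a factor 2 from bounding a sum of two
  -- squares by twice the square of the maximum.
  refine ⟨EisensteinSeries.r T ^ 2 / 8, by have := EisensteinSeries.r_pos T; positivity,
    fun p => ?_⟩
  by_cases hp : p = 0
  · subst hp
    simp [halfPeriod]
  have hx : (![p.1, p.2] : Fin 2 → ℤ) ≠ 0 := by
    intro h
    exact hp (Prod.ext (by simpa using congrFun h 0) (by simpa using congrFun h 1))
  have h := EisensteinSeries.r_mul_max_le T hx
  set x : Fin 2 → ℤ := ![p.1, p.2]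
  have h0 : |(p.1 : ℝ)| ≤ ‖x‖ := by
    simpa [x, Int.norm_eq_abs] using norm_le_pi_norm x 0
  have h1 : |(p.2 : ℝ)| ≤ ‖x‖ := by
    simpa [x, Int.norm_eq_abs] using norm_le_pi_norm x 1
  have hsq : (p.1 : ℝ) ^ 2 + (p.2 : ℝ) ^ 2 ≤ 2 * ‖x‖ ^ 2 := by
    rw [← sq_abs (p.1 : ℝ), ← sq_abs (p.2 : ℝ)]
    nlinarith [abs_nonneg (p.1 : ℝ), abs_nonneg (p.2 : ℝ)]
  have hν : ‖halfPeriod τ p‖ = ‖(x 0 : ℂ) * (T : ℂ) + x 1‖ / 2 := by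
    simp [halfPeriod, x, T]
  rw [hν, div_pow]
  have h2 := pow_le_pow_left₀ (mul_nonneg (EisensteinSeries.r_pos T).le (norm_nonneg _)) h 2
  have h3 := mul_le_mul_of_nonneg_left hsq (sq_nonneg (EisensteinSeries.r T))
  linarith

lemma summable_exp_neg_sq_add_sq {κ : ℝ} (hκ : 0 < κ) :
    Summable fun p : ℤ × ℤ => Real.exp (-κ * ((p.1 : ℝ) ^ 2 + (p.2 : ℝ) ^ 2)) := by
  have h := summable_exp_quadratic hκ 0
  refine (h.mul_of_nonneg h (fun _ => (Real.exp_pos _).le) (fun _ => (Real.exp_pos _).le)).congr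
    fun p => ?_
  rw [← Real.exp_add]
  ring_nf

lemma eventually_one_le_norm_add_halfPeriod {τ : ℂ} (hτ : 0 < τ.im) (z : ℂ) :
    ∀ᶠ p in Filter.cofinite, 1 ≤ ‖z + halfPeriod τ p‖ := by
  obtain ⟨κ, hκ, h⟩ := exists_norm_halfPeriod_ge hτ
  have hev := (summable_exp_neg_sq_add_sq hκ).tendsto_cofinite_zero.eventually_lt_const
    (Real.exp_pos (-(1 + ‖z‖) ^ 2))
  filter_upwards [hev] with p hp
  have h1 : (1 + ‖z‖) ^ 2 < ‖halfPeriod τ p‖ ^ 2 := by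
    have := Real.exp_lt_exp.mp hp
    linarith [h p]
  have h2 := lt_of_pow_lt_pow_left₀ 2 (norm_nonneg _) h1
  have h3 := norm_sub_norm_le (halfPeriod τ p) (-z)
  rw [norm_neg, sub_neg_eq_add, add_comm _ z] at h3
  linarith

lemma summable_latticeKernel {M : ℕ} (hM : 0 < M) {τ : ℂ} (hτ : 0 < τ.im) (z : ℂ)
    {φ : ℤ × ℤ → ℂ} {C : ℝ} (hφ : ∀ p, ‖φ p‖ ≤ C) :
    Summable fun p => φ p * latticeKernel M τ z p := by
  obtain ⟨κ, hκ, h⟩ := exists_norm_halfPeriod_ge hτ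
  have hM' : (0 : ℝ) < M := by exact_mod_cast hM
  set A : ℝ := π * M / (4 * τ.im) with hA
  have hA0 : 0 < A := by positivity
  refine Summable.of_norm_bounded_eventually
    ((summable_exp_neg_sq_add_sq (κ := A / 2 * κ) (by positivity)).mul_left
      (C * Real.exp (A * (3 * ‖z‖ ^ 2)))) ?_
  filter_upwards [eventually_one_le_norm_add_halfPeriod hτ z] with p hp
  have hC : 0 ≤ C := (norm_nonneg _).trans (hφ p)
  set ν := halfPeriod τ p
  -- The cross term 2ν̄z costs at most |ν|²/2 + 2|z|², so the quadratic decay in ν survives.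
  have hre : ‖ν‖ ^ 2 / 2 - 3 * ‖z‖ ^ 2 ≤ (z ^ 2 + ν * conj ν + 2 * conj ν * z).re := by
    rw [← normSq_eq_norm_sq, ← normSq_eq_norm_sq, normSq_apply, normSq_apply]
    simp only [add_re, mul_re, conj_re, conj_im, pow_two, mul_im, re_ofNat, im_ofNat]
    nlinarith [sq_nonneg (ν.re + 2 * z.re), sq_nonneg (ν.im + 2 * z.im), sq_nonneg z.re,
      sq_nonneg z.im]
  have hnorm : ‖cexp (-(π * M / (4 * τ.im)) * (z ^ 2 + ν * conj ν + 2 * conj ν * z))‖ ≤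
      Real.exp (A * (3 * ‖z‖ ^ 2)) * Real.exp (-(A / 2 * κ) * ((p.1 : ℝ) ^ 2 + (p.2 : ℝ) ^ 2)) := by
    have hc : (-(π * M / (4 * τ.im)) : ℂ) = ((-A : ℝ) : ℂ) := by
      rw [hA]
      push_cast
      rfl
    rw [hc, Complex.norm_exp, re_ofReal_mul, ← Real.exp_add]
    refine Real.exp_le_exp.mpr ?_
    have h1 := mul_le_mul_of_nonneg_left hre hA0.le
    have h2 := mul_le_mul_of_nonneg_left (h p) (show 0 ≤ A / 2 by positivity)
    linarith
  rw [norm_mul, latticeKernel, norm_div, mul_assoc C]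
  refine mul_le_mul (hφ p) ?_ (by positivity) hC
  exact (div_le_self (norm_nonneg _) hp).trans hnorm

lemma latticeSum_add {M : ℕ} (hM : 0 < M) {τ : ℂ} (hτ : 0 < τ.im) (z : ℂ)
    {φ ψ : ℤ × ℤ → ℂ} {C D : ℝ} (hφ : ∀ p, ‖φ p‖ ≤ C) (hψ : ∀ p, ‖ψ p‖ ≤ D) :
    latticeSum M (fun p => φ p + ψ p) τ z = latticeSum M φ τ z + latticeSum M ψ τ z := by
  rw [latticeSum, latticeSum, latticeSum, ← Summable.tsum_add
    (summable_latticeKernel hM hτ z hφ) (summable_latticeKernel hM hτ z hψ)]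
  exact tsum_congr fun p => add_mul _ _ _

lemma latticeSum_const_mul (M : ℕ) (a : ℂ) (φ : ℤ × ℤ → ℂ) (τ z : ℂ) :
    latticeSum M (fun p => a * φ p) τ z = a * latticeSum M φ τ z := by
  rw [latticeSum, latticeSum, ← tsum_mul_left]
  exact tsum_congr fun p => mul_assoc _ _ _

/-- Negating both z and ν preserves the exponent and changes the sign of the denominator. This later
turns the difference defining `PhiTilde` into a symmetrised weight. -/
lemma latticeSum_neg_right (M : ℕ) (φ : ℤ × ℤ → ℂ) (τ z : ℂ) :
    latticeSum M φ τ (-z) = -latticeSum M (fun p => φ (-p)) τ z := by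
  rw [latticeSum, ← (Equiv.neg (ℤ × ℤ)).tsum_eq, latticeSum, ← tsum_neg]
  refine tsum_congr fun p => ?_
  have hν : halfPeriod τ (-p) = -halfPeriod τ p := by
    simp [halfPeriod]
    ring
  have hden : -z + -halfPeriod τ p = -(z + halfPeriod τ p) := by ring
  rw [Equiv.neg_apply, latticeKernel, latticeKernel, hν, map_neg, hden, div_neg, mul_neg]
  ring_nf

/-- Here a(τ + 1) + (c - a) = aτ + c and Im τ is unchanged, so only the labels of the half periods
move. -/
lemma latticeSum_T (M : ℕ) (φ : ℤ × ℤ → ℂ) (τ z : ℂ) :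
    latticeSum M φ (τ + 1) z = latticeSum M (fun p => φ (p.1, p.2 - p.1)) τ z := by
  let e : ℤ × ℤ ≃ ℤ × ℤ :=
    { toFun := fun p => (p.1, p.2 - p.1)
      invFun := fun p => (p.1, p.2 + p.1)
      left_inv := fun p => by simp
      right_inv := fun p => by simp }
  rw [latticeSum, ← e.tsum_eq]
  refine tsum_congr fun p => ?_
  have hν : halfPeriod (τ + 1) (e p) = halfPeriod τ p := by
    simp only [halfPeriod, e, Equiv.coe_fn_mk]
    push_cast
    ring
  rw [latticeKernel, hν, latticeKernel, add_im, one_im, add_zero]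
  rfl

/-- The half periods of -1/τ are the ν/τ, and Im(-1/τ) = Im τ/|τ|². The terms |ν|²/Im τ and ν̄z/Im τ
are therefore invariant. Only z²/Im τ changes, by τ̄/τ = 1 - 2i Im τ/τ, and this yields the index
factor. -/
lemma latticeSum_S (M : ℕ) (φ : ℤ × ℤ → ℂ) {τ : ℂ} (hτ : 0 < τ.im) (z : ℂ) :
    latticeSum M φ (-1 / τ) (z / τ) = τ * cexp (π * I * M * z ^ 2 / (2 * τ)) *
      latticeSum M (fun p => φ (-p.2, p.1)) τ z := by
  have hτ0 : τ ≠ 0 := by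
    rintro rfl
    simp at hτ
  have hy0 : (τ.im : ℂ) ≠ 0 := by exact_mod_cast hτ.ne'
  have hc0 : conj τ ≠ 0 := by simpa using hτ0
  let e : ℤ × ℤ ≃ ℤ × ℤ :=
    { toFun := fun p => (-p.2, p.1)
      invFun := fun p => (p.2, -p.1)
      left_inv := fun p => by simp
      right_inv := fun p => by simp }
  rw [latticeSum, ← e.tsum_eq, latticeSum, ← tsum_mul_left]
  refine tsum_congr fun p => ?_
  have hν : halfPeriod (-1 / τ) (e p) = halfPeriod τ p / τ := by
    simp only [halfPeriod, e, Equiv.coe_fn_mk]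
    push_cast
    field_simp
    ring
  have him : (((-1 / τ).im : ℝ) : ℂ) = τ.im / (τ * conj τ) := by
    rw [mul_conj]
    simp [neg_div, inv_im]
  have hconj : conj τ = τ - 2 * I * τ.im := by
    apply Complex.ext <;> simp; ring
  have hexp : -(π * M / (4 * (((-1 / τ).im : ℝ) : ℂ))) * ((z / τ) ^ 2 + halfPeriod τ p / τ *
      conj (halfPeriod τ p / τ) + 2 * conj (halfPeriod τ p / τ) * (z / τ)) =
      π * I * M * z ^ 2 / (2 * τ) + -(π * M / (4 * τ.im)) * (z ^ 2 + halfPeriod τ p *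
      conj (halfPeriod τ p) + 2 * conj (halfPeriod τ p) * z) := by
    rw [him, map_div₀]
    field_simp
    linear_combination (-2 * M * z ^ 2 : ℂ) * hconj
  rw [latticeKernel, hν, hexp, Complex.exp_add, latticeKernel, ← add_div]
  change φ (-p.2, p.1) * _ = _
  rw [div_div_eq_mul_div]
  ring

/-- The phase of the Appell function on the coset `(a₀ + 4ℤ) × (c₀ + 2ℤ)`, where `k = 2s`. -/
noncomputable def cosetPhase (M k : ℕ) (a₀ c₀ : ℤ) (p : ℤ × ℤ) : ℂ :=
  if 4 ∣ p.1 - a₀ ∧ 2 ∣ p.2 - c₀ then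
    cexp (-(π * I) * ((k + M * ((p.1 - a₀) / 4)) * ((p.2 - c₀) / 2)
      + M / 4 * (2 * ((p.1 - a₀) / 4) * c₀ - ((p.2 - c₀) / 2) * a₀)))
  else 0

lemma cosetPhase_apply (M k : ℕ) (a₀ c₀ j b : ℤ) :
    cosetPhase M k a₀ c₀ (a₀ + 4 * j, c₀ + 2 * b) =
      cexp (-(π * I) * ((k + M * j) * b + M / 4 * (2 * j * c₀ - b * a₀))) := by
  rw [cosetPhase, if_pos (by simp)]
  push_cast
  ring_nf

lemma cosetPhase_eq_zero {M k : ℕ} {a₀ c₀ : ℤ} {p : ℤ × ℤ}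
    (h : ¬ (4 ∣ p.1 - a₀ ∧ 2 ∣ p.2 - c₀)) : cosetPhase M k a₀ c₀ p = 0 := if_neg h

lemma norm_cosetPhase_le (M k : ℕ) (a₀ c₀ : ℤ) (p : ℤ × ℤ) : ‖cosetPhase M k a₀ c₀ p‖ ≤ 1 := by
  rw [cosetPhase]
  split_ifs
  · refine le_of_eq ((norm_exp_of_eq 0 (-π * ((k + M * ((p.1 - a₀) / 4)) * ((p.2 - c₀) / 2)
      + M / 4 * (2 * ((p.1 - a₀) / 4) * c₀ - ((p.2 - c₀) / 2) * a₀))) ?_).trans Real.exp_zero)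
    push_cast
    ring
  · simp

/-- Apart from a unimodular phase and a prefactor independent of (j, b), the exponent depends on (j,
b) only through the half period ν. The part a₀²τ of the prefactor is what the argument t of
`PhiTilde` will cancel. -/
lemma appellExponent_eq {M : ℕ} (hM : 0 < M) (k : ℕ) {τ : ℂ} (hτ : 0 < τ.im) (z : ℂ)
    (a₀ c₀ j b : ℤ) :
    appellExponent ((M : ℝ) / 2) ((k : ℝ) / 2) (2 * τ) (z + halfPeriod τ (a₀, c₀))
      (z - halfPeriod τ (a₀, c₀)) j b =
    π * I * M * (a₀ ^ 2 * τ + a₀ * c₀) / 8 +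
      (-(π * I) * ((k + M * j) * b + M / 4 * (2 * j * c₀ - b * a₀)) +
      -(π * M / (4 * τ.im)) * (z ^ 2 + halfPeriod τ (a₀ + 4 * j, c₀ + 2 * b) *
        conj (halfPeriod τ (a₀ + 4 * j, c₀ + 2 * b))
        + 2 * conj (halfPeriod τ (a₀ + 4 * j, c₀ + 2 * b)) * z)) := by
  have hy0 : (τ.im : ℂ) ≠ 0 := by exact_mod_cast hτ.ne'
  have hM0 : (M : ℂ) ≠ 0 := by exact_mod_cast hM.ne'
  have hw : (z + halfPeriod τ (a₀, c₀) - (z - halfPeriod τ (a₀, c₀))) / 2 =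
      halfPeriod τ (a₀, c₀) := by ring
  have hwim : (halfPeriod τ (a₀, c₀)).im = a₀ * τ.im / 2 := by
    simp [halfPeriod]
  have h2im : (2 * τ).im = 2 * τ.im := by simp
  have hconj : conj τ = τ - 2 * I * τ.im := by
    apply Complex.ext <;> simp; ring
  rw [appellExponent, hw, hwim, h2im]
  simp only [halfPeriod, map_div₀, map_add, map_mul, map_intCast, map_ofNat, hconj]
  push_cast
  field_simp
  ring_nf

end

end N3

namespace N3

section

open Complex
open scoped Real

/-! ### Appell functions at half periods -/

lemma halfPeriod_neg (τ : ℂ) (p : ℤ × ℤ) : halfPeriod τ (-p) = -halfPeriod τ p := by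
  simp [halfPeriod]
  ring

/-- The modulus is 2τ, so in units of half periods of τ the poles fill the coset (a₀, c₀) + 4ℤ × 2ℤ.
The phase is extended by zero to all of ℤ². -/
lemma modifiedAppell_eq_latticeSum {M : ℕ} (hM : 0 < M) (k : ℕ) {τ : ℂ} (hτ : 0 < τ.im) (z : ℂ)
    (a₀ c₀ : ℤ)
    (hz : ∀ p : ℤ × ℤ, 4 ∣ p.1 - a₀ → 2 ∣ p.2 - c₀ → z + halfPeriod τ p ≠ 0) :
    modifiedAppell M ((M : ℝ) / 2) ((k : ℝ) / 2) (2 * τ) (z + halfPeriod τ (a₀, c₀))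
      (z - halfPeriod τ (a₀, c₀)) =
    -(1 / (2 * π * I)) * (cexp (π * I * M * (a₀ ^ 2 * τ + a₀ * c₀) / 8) *
      latticeSum M (cosetPhase M k a₀ c₀) τ z) := by
  have hM' : (0 : ℝ) < M := by exact_mod_cast hM
  let g : ℤ × ℤ → ℤ × ℤ := fun p => (a₀ + 4 * p.1, c₀ + 2 * p.2)
  have hg : Function.Injective g := by
    rintro ⟨a, b⟩ ⟨a', b'⟩ h
    simp only [g, Prod.mk.injEq] at h
    ext <;> dsimp only <;> lia
  have hden : ∀ p : ℤ × ℤ, z + halfPeriod τ (a₀, c₀) + 2 * τ * p.1 + p.2 =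
      z + halfPeriod τ (g p) := fun p => by
    simp only [halfPeriod, g]
    push_cast
    ring
  have hterm : ∀ p : ℤ × ℤ, cexp (appellExponent ((M : ℝ) / 2) ((k : ℝ) / 2) (2 * τ)
      (z + halfPeriod τ (a₀, c₀)) (z - halfPeriod τ (a₀, c₀)) p.1 p.2) /
        (z + halfPeriod τ (a₀, c₀) + 2 * τ * p.1 + p.2) =
      cexp (π * I * M * (a₀ ^ 2 * τ + a₀ * c₀) / 8) *
        (cosetPhase M k a₀ c₀ (g p) * latticeKernel M τ z (g p)) := fun p => by
    rw [hden, appellExponent_eq hM k hτ, Complex.exp_add, Complex.exp_add, cosetPhase_apply,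
      latticeKernel]
    ring
  have hsum : Summable fun p => cosetPhase M k a₀ c₀ p * latticeKernel M τ z p :=
    summable_latticeKernel hM hτ z (norm_cosetPhase_le M k a₀ c₀)
  rw [modifiedAppell_eq_tsum (by positivity) (by ring) _ (by simpa using hτ)]
  · simp_rw [hterm]
    rw [tsum_mul_left, latticeSum, hg.tsum_eq (f := fun p =>
      cosetPhase M k a₀ c₀ p * latticeKernel M τ z p)]
    intro p hp
    have : 4 ∣ p.1 - a₀ ∧ 2 ∣ p.2 - c₀ := by
      by_contra h
      exact hp (by simp only [cosetPhase_eq_zero h, zero_mul])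
    obtain ⟨⟨j, hj⟩, b, hb⟩ := this
    exact ⟨(j, b), Prod.ext (by simp only [g]; lia) (by simp only [g]; lia)⟩
  · intro j b
    have := hden (j, b)
    dsimp only at this
    rw [this]
    exact hz _ (by simp [g]) (by simp [g])
  · simp_rw [hterm]
    exact (hsum.comp_injective hg).mul_left _

/-- The weight function on the half periods attached to `Φ̃^{[M/2, k/2]}` at the half period
`(a₀, c₀)`. -/
noncomputable def charWeight (M k : ℕ) (a₀ c₀ : ℤ) (p : ℤ × ℤ) : ℂ :=
  cexp (π * I * M * (a₀ * c₀) / 8) * (cosetPhase M k a₀ c₀ p + cosetPhase M k a₀ c₀ (-p))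

lemma exists_norm_charWeight_le (M k : ℕ) (a₀ c₀ : ℤ) : ∃ C, ∀ p, ‖charWeight M k a₀ c₀ p‖ ≤ C := by
  refine ⟨‖cexp (π * I * M * (a₀ * c₀) / 8)‖ * (1 + 1), fun p => ?_⟩
  rw [charWeight, norm_mul]
  exact mul_le_mul_of_nonneg_left ((norm_add_le _ _).trans (add_le_add
    (norm_cosetPhase_le _ _ _ _ _) (norm_cosetPhase_le _ _ _ _ _))) (norm_nonneg _)

/-- The second half of `PhiTilde` is the first at -z, and reflection turns the difference into the
even weight. The choice t = a₀²τ/8 removes the last dependence on τ outside the kernel. -/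
theorem PhiTilde_eq_latticeSum {M : ℕ} (hM : 0 < M) (k : ℕ) {τ : ℂ} (hτ : 0 < τ.im) (z : ℂ)
    (a₀ c₀ : ℤ)
    (hz : ∀ p : ℤ × ℤ, 2 ∣ p.1 - a₀ → 2 ∣ p.2 - c₀ → z + halfPeriod τ p ≠ 0) :
    PhiTilde ((M : ℝ) / 2) ((k : ℝ) / 2) (2 * τ) (z + halfPeriod τ (a₀, c₀))
      (z - halfPeriod τ (a₀, c₀)) (a₀ ^ 2 * τ / 8) =
    -(1 / (2 * π * I)) * latticeSum M (charWeight M k a₀ c₀) τ z := by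
  have h42 : ∀ {n : ℤ}, 4 ∣ n → 2 ∣ n := fun h => (by norm_num : (2 : ℤ) ∣ 4).trans h
  have e1 : -(z - halfPeriod τ (a₀, c₀)) = -z + halfPeriod τ (a₀, c₀) := by ring
  have e2 : -(z + halfPeriod τ (a₀, c₀)) = -z - halfPeriod τ (a₀, c₀) := by ring
  rw [PhiTilde_eq_modifiedAppell (M := M) (by ring), e1, e2,
    modifiedAppell_eq_latticeSum hM k hτ z a₀ c₀ fun p h1 h2 => hz p (h42 h1) h2,
    modifiedAppell_eq_latticeSum hM k hτ (-z) a₀ c₀, latticeSum_neg_right]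
  · have hw : latticeSum M (charWeight M k a₀ c₀) τ z = cexp (π * I * M * (a₀ * c₀) / 8) *
        (latticeSum M (cosetPhase M k a₀ c₀) τ z +
          latticeSum M (fun p => cosetPhase M k a₀ c₀ (-p)) τ z) := by
      rw [← latticeSum_add hM hτ z (norm_cosetPhase_le M k a₀ c₀)
        (fun p => norm_cosetPhase_le M k a₀ c₀ (-p)), ← latticeSum_const_mul]
      rfl
    have hexp : cexp (-2 * π * I * ((M / 2 : ℝ) : ℂ) * (a₀ ^ 2 * τ / 8)) *
        cexp (π * I * M * (a₀ ^ 2 * τ + a₀ * c₀) / 8) = cexp (π * I * M * (a₀ * c₀) / 8) := by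
      rw [← Complex.exp_add]
      congr 1
      push_cast
      ring
    rw [hw, ← hexp]
    ring
  -- Poles at -z lie in the coset of -a₀ modulo 4. The non-vanishing hypothesis covers both cosets
  -- because it asks only for congruence modulo 2.
  · intro p h1 h2 h
    refine hz (-p) ?_ ?_ ?_
    · obtain ⟨x, hx⟩ := h1
      exact ⟨-2 * x - a₀, by simp only [Prod.fst_neg]; lia⟩
    · obtain ⟨x, hx⟩ := h2
      exact ⟨-x - c₀, by simp only [Prod.snd_neg]; lia⟩
    · rw [halfPeriod_neg]
      linear_combination -h

/-! ### Theta functions -/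

lemma vartheta_eq_jacobiTheta₂ (a b : ℕ) (τ z : ℂ) : vartheta a b τ z =
    cexp (π * I * (a ^ 2 * τ / 4 + a * (z + b / 2))) *
      jacobiTheta₂ (z + a * τ / 2 + b / 2) τ := by
  rw [vartheta, jacobiTheta₂, ← tsum_mul_left]
  refine tsum_congr fun n => ?_
  rw [jacobiTheta₂_term, ← Complex.exp_add]
  ring_nf

/-- The reflection n ↦ -a - n reverses the sign of every term when a and c are odd. -/
lemma jacobiTheta₂_halfPeriod_eq_zero (τ : ℂ) {p : ℤ × ℤ} (h1 : Odd p.1) (h2 : Odd p.2) :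
    jacobiTheta₂ (halfPeriod τ p) τ = 0 := by
  suffices h : jacobiTheta₂ (halfPeriod τ p) τ = -jacobiTheta₂ (halfPeriod τ p) τ from
    CharZero.eq_neg_self_iff.mp h
  conv_lhs => rw [jacobiTheta₂, ← (Equiv.subLeft (-p.1)).tsum_eq]
  rw [jacobiTheta₂, ← tsum_neg]
  refine tsum_congr fun n => ?_
  have hodd : Odd (p.1 * p.2) := h1.mul h2
  obtain ⟨x, hx⟩ := hodd
  obtain ⟨y, hy⟩ := h2
  have hx' : (p.1 : ℂ) * p.2 = 2 * x + 1 := by exact_mod_cast hx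
  have hy' : (p.2 : ℂ) = 2 * y + 1 := by exact_mod_cast hy
  have hneg : ∀ w : ℂ, -cexp w = cexp (w + π * I) := fun w => by
    rw [Complex.exp_add, Complex.exp_pi_mul_I, mul_neg_one]
  rw [jacobiTheta₂_term, jacobiTheta₂_term, hneg, Complex.exp_eq_exp_iff_exists_int]
  refine ⟨-x - 1 - n * (2 * y + 1), ?_⟩
  simp only [halfPeriod, Equiv.subLeft_apply]
  push_cast
  linear_combination (-π * I : ℂ) * hx' - (2 * π * I * n : ℂ) * hy'

/-- The possible poles of the lattice sums are zeros of the theta function in the denominator, so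
regularity excludes them. -/
lemma add_halfPeriod_ne_zero {a b : ℕ} {τ z : ℂ} (h : vartheta a b τ z ≠ 0) {p : ℤ × ℤ}
    (h1 : Odd (p.1 + a)) (h2 : Odd (p.2 + b)) : z + halfPeriod τ p ≠ 0 := by
  intro h0
  refine h ?_
  have hz : z + a * τ / 2 + b / 2 = halfPeriod τ (a - p.1, b - p.2) := by
    rw [eq_neg_of_add_eq_zero_left h0]
    simp only [halfPeriod]
    push_cast
    ring
  rw [vartheta_eq_jacobiTheta₂, hz, jacobiTheta₂_halfPeriod_eq_zero, mul_zero]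
  · dsimp only; grind
  · dsimp only; grind

/-! ### The characters as lattice sums -/

/-- The four families sit at the half periods (1, -1), (1, 0), (2, -1) and (0, -1). In each case the
prescribed t equals a₀²τ/8. -/
lemma chPlus_eq {M : ℕ} (hM : 0 < M) (m₂ : ℕ) {τ z : ℂ} (hτ : 0 < τ.im)
    (h : vartheta 0 0 τ z ≠ 0) : chPlus M m₂ τ z =
      -(1 / (2 * π * I)) * latticeSum M (charWeight M (m₂ + 1) 1 (-1)) τ z / RPlus τ z := by
  rw [← PhiTilde_eq_latticeSum hM (m₂ + 1) hτ z 1 (-1), chPlus]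
  · congr 2
    · push_cast; ring
    · simp only [halfPeriod]; push_cast; ring
    · simp only [halfPeriod]; push_cast; ring
    · push_cast; ring
  · exact fun p h1 h2 => add_halfPeriod_ne_zero h (by grind) (by grind)

lemma chMinus_eq {M : ℕ} (hM : 0 < M) (m₂ : ℕ) {τ z : ℂ} (hτ : 0 < τ.im)
    (h : vartheta 0 1 τ z ≠ 0) : chMinus M m₂ τ z =
      -(1 / (2 * π * I)) * latticeSum M (charWeight M (m₂ + 1) 1 0) τ z / RMinus τ z := by
  rw [← PhiTilde_eq_latticeSum hM (m₂ + 1) hτ z 1 0, chMinus]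
  · congr 2
    · push_cast; ring
    · simp only [halfPeriod]; push_cast; ring
    · simp only [halfPeriod]; push_cast; ring
    · push_cast; ring
  · exact fun p h1 h2 => add_halfPeriod_ne_zero h (by grind) (by grind)

lemma chTwPlus_eq {M : ℕ} (hM : 0 < M) (m₂ : ℕ) {τ z : ℂ} (hτ : 0 < τ.im)
    (h : vartheta 1 0 τ z ≠ 0) : chTwPlus M m₂ τ z =
      -(1 / (2 * π * I)) * latticeSum M (charWeight M (m₂ + 1) 2 (-1)) τ z / RTw τ z := by
  rw [← PhiTilde_eq_latticeSum hM (m₂ + 1) hτ z 2 (-1), chTwPlus]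
  · congr 2
    · push_cast; ring
    · simp only [halfPeriod]; push_cast; ring
    · simp only [halfPeriod]; push_cast; ring
    · push_cast; ring
  · exact fun p h1 h2 => add_halfPeriod_ne_zero h (by grind) (by grind)

lemma chTwMinus_eq {M : ℕ} (hM : 0 < M) (m₂ : ℕ) {τ z : ℂ} (hτ : 0 < τ.im)
    (h : vartheta 1 0 τ z ≠ 0) : chTwMinus M m₂ τ z =
      -(1 / (2 * π * I)) * latticeSum M (charWeight M (m₂ + 1) 0 (-1)) τ z / RTw τ z := by
  rw [← PhiTilde_eq_latticeSum hM (m₂ + 1) hτ z 0 (-1), chTwMinus]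
  · congr 2
    · push_cast; ring
    · simp only [halfPeriod]; push_cast; ring
    · simp only [halfPeriod]; push_cast; ring
    · push_cast; ring
  · exact fun p h1 h2 => add_halfPeriod_ne_zero h (by grind) (by grind)

end

end N3

namespace N3

section

open Complex
open scoped Real

/-! ### Transformations of the theta functions -/

lemma vartheta_one_T (b : ℕ) (τ z : ℂ) :
    vartheta 1 b (τ + 1) z = cexp (π * I / 4) * vartheta 1 b τ z := by
  rw [vartheta, vartheta, ← tsum_mul_left]
  refine tsum_congr fun n => ?_
  rw [← Complex.exp_add, Complex.exp_eq_exp_iff_exists_int]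
  obtain ⟨k, hk⟩ := Int.even_mul_succ_self n
  have hk' : (n : ℂ) * (n + 1) = k + k := by exact_mod_cast hk
  refine ⟨k, ?_⟩
  push_cast
  linear_combination (π * I : ℂ) * hk'

lemma vartheta_zero_zero_T (τ z : ℂ) : vartheta 0 0 (τ + 1) z = vartheta 0 1 τ z := by
  refine tsum_congr fun n => ?_
  rw [Complex.exp_eq_exp_iff_exists_int]
  obtain ⟨k, hk⟩ := Int.even_mul_pred_self n
  have hk' : (n : ℂ) * (n - 1) = k + k := by exact_mod_cast hk
  refine ⟨k, ?_⟩
  push_cast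
  linear_combination (π * I : ℂ) * hk'

lemma vartheta_zero_one_T (τ z : ℂ) : vartheta 0 1 (τ + 1) z = vartheta 0 0 τ z := by
  refine tsum_congr fun n => ?_
  rw [Complex.exp_eq_exp_iff_exists_int]
  obtain ⟨k, hk⟩ := Int.even_mul_succ_self n
  have hk' : (n : ℂ) * (n + 1) = k + k := by exact_mod_cast hk
  refine ⟨k, ?_⟩
  push_cast
  linear_combination (π * I : ℂ) * hk'

lemma vartheta_S (a b : ℕ) {τ : ℂ} (hτ : τ ≠ 0) (z : ℂ) :
    vartheta a b (-1 / τ) (z / τ) = (-I * τ) ^ (1 / 2 : ℂ) * cexp (π * I * z ^ 2 / τ) *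
      cexp (-(π * I * a * b) / 2) * vartheta b a τ z := by
  -- Periodicity trades a/2 for -a/2, so that division by τ produces the characteristic a(-1/τ)/2.
  have hper : jacobiTheta₂ (z + b * τ / 2 + a / 2) τ = jacobiTheta₂ (z - a / 2 + b * τ / 2) τ := by
    have hp : Function.Periodic (fun w => jacobiTheta₂ w τ) 1 := fun w => jacobiTheta₂_add_left w τ
    have := hp.nat_mul a (z - a / 2 + b * τ / 2)
    rw [← this]
    ring_nf
  have hfe := jacobiTheta₂_functional_equation (z - a / 2 + b * τ / 2) τ
  have hne : (-I * τ) ^ (1 / 2 : ℂ) ≠ 0 := by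
    rw [Ne, cpow_eq_zero_iff]
    simp [hτ]
  have harg : (z - a / 2 + b * τ / 2) / τ = z / τ + a * (-1 / τ) / 2 + b / 2 := by
    field_simp
    ring
  rw [vartheta_eq_jacobiTheta₂, vartheta_eq_jacobiTheta₂, hper, hfe, harg]
  generalize jacobiTheta₂ _ _ = J
  have hexp : cexp (π * I * (a ^ 2 * (-1 / τ) / 4 + a * (z / τ + b / 2))) =
      cexp (π * I * z ^ 2 / τ) * cexp (-(π * I * a * b) / 2) *
        (cexp (π * I * (b ^ 2 * τ / 4 + b * (z + a / 2))) *
          cexp (-π * I * (z - a / 2 + b * τ / 2) ^ 2 / τ)) := by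
    rw [← Complex.exp_add, ← Complex.exp_add, ← Complex.exp_add]
    congr 1
    field_simp
    ring
  rw [hexp]
  field_simp

/-! ### Transformations of the eta function -/

lemma sqrt_ofReal_mul {r : ℝ} (hr : 0 < r) {x : ℂ} (hx : x ≠ 0) :
    Complex.sqrt (r * x) = (√r : ℝ) * Complex.sqrt x := by
  have hr' : (r : ℂ) ≠ 0 := by exact_mod_cast hr.ne'
  rw [Complex.sqrt, Complex.sqrt, cpow_def_of_ne_zero (mul_ne_zero hr' hx),
    cpow_def_of_ne_zero hx, log_ofReal_mul hr hx, add_mul, Complex.exp_add, Real.sqrt_eq_rpow,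
    Real.rpow_def_of_pos hr]
  push_cast
  ring_nf

lemma sq_complex_sqrt (x : ℂ) : Complex.sqrt x ^ 2 = x := by
  rw [Complex.sqrt, ← cpow_nat_mul]
  simp

lemma eta_S {τ : ℂ} (hτ : 0 < τ.im) : ModularForm.eta (-1 / τ) =
    (Complex.sqrt I)⁻¹ * (Complex.sqrt τ * ModularForm.eta τ) := by
  simpa using ModularForm.eta_comp_eq_csqrt_I_inv hτ

lemma eta_T (τ : ℂ) : ModularForm.eta (τ + 1) = cexp (π * I / 12) * ModularForm.eta τ := by
  have h : ∀ n, ModularForm.eta_q n (τ + 1) = ModularForm.eta_q n τ := fun n => by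
    rw [ModularForm.eta_q_eq_pow, ModularForm.eta_q_eq_pow, mul_add, mul_one, Complex.exp_add,
      Complex.exp_two_pi_mul_I, mul_one]
  simp only [ModularForm.eta, h]
  rw [Function.Periodic.qParam, Function.Periodic.qParam, ← mul_assoc, ← Complex.exp_add]
  congr 2
  push_cast
  ring

/-- Euler's product `∏ (1 - xⁿ)`. -/
noncomputable def eulerProd (x : ℂ) : ℂ := ∏' n : ℕ, (1 - x ^ (n + 1))

lemma multipliable_one_sub_odd_pow {x : ℂ} (hx : ‖x‖ < 1) :
    Multipliable fun n : ℕ => 1 - x ^ (2 * n + 1) := by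
  have h : Summable fun n : ℕ => ‖-x ^ (2 * n + 1)‖ := by
    have := (summable_geometric_of_lt_one (norm_nonneg x) hx).comp_injective
      (i := fun n : ℕ => 2 * n + 1) (fun a b h => by simpa using h)
    simpa [Function.comp_def] using this
  simpa [sub_eq_add_neg] using multipliable_one_add_of_summable h

lemma eulerProd_eq_odd_mul {x : ℂ} (hx : ‖x‖ < 1) :
    eulerProd x = (∏' n : ℕ, (1 - x ^ (2 * n + 1))) * eulerProd (x ^ 2) := by
  have hx2 : ‖x ^ 2‖ < 1 := by
    rw [norm_pow]
    exact pow_lt_one₀ (norm_nonneg _) hx two_ne_zero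
  have h : ∀ k : ℕ, 1 - (x ^ 2) ^ (k + 1) = 1 - x ^ (2 * k + 1 + 1) := fun k => by
    rw [← pow_mul]
    ring_nf
  rw [eulerProd, eulerProd, ← tprod_even_mul_odd (f := fun n => 1 - x ^ (n + 1))
    (multipliable_one_sub_odd_pow hx)
    ((ModularForm.multipliable_one_sub_pow hx2).congr h)]
  simp_rw [h]

/-- For odd exponents (1 - xⁿ)(1 + xⁿ) = 1 - x²ⁿ. The rest is the odd-even splitting of the product
at x, -x and x². -/
lemma eulerProd_mul_neg {x : ℂ} (hx : ‖x‖ < 1) :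
    eulerProd x * eulerProd (-x) * eulerProd (x ^ 4) = eulerProd (x ^ 2) ^ 3 := by
  have hx2 : ‖x ^ 2‖ < 1 := by
    rw [norm_pow]
    exact pow_lt_one₀ (norm_nonneg _) hx two_ne_zero
  have hx' : ‖-x‖ < 1 := by rwa [norm_neg]
  have hodd : (∏' n : ℕ, (1 - x ^ (2 * n + 1))) * ∏' n : ℕ, (1 - (-x) ^ (2 * n + 1)) =
      ∏' n : ℕ, (1 - (x ^ 2) ^ (2 * n + 1)) := by
    rw [← (multipliable_one_sub_odd_pow hx).tprod_mul (multipliable_one_sub_odd_pow hx')]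
    refine tprod_congr fun n => ?_
    rw [Odd.neg_pow ⟨n, rfl⟩, ← pow_mul]
    ring
  have h1 := eulerProd_eq_odd_mul hx
  have h2 := eulerProd_eq_odd_mul hx'
  have h3 := eulerProd_eq_odd_mul hx2
  rw [neg_sq] at h2
  rw [← pow_mul] at h3
  rw [h1, h2]
  linear_combination (eulerProd (x ^ 2) ^ 2 * eulerProd (x ^ 4)) * hodd - eulerProd (x ^ 2) ^ 2 * h3

lemma eta_eq_eulerProd (τ : ℂ) :
    ModularForm.eta τ = cexp (π * I * τ / 12) * eulerProd (cexp (2 * π * I * τ)) := by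
  rw [ModularForm.eta, eulerProd, Function.Periodic.qParam]
  congr 2
  · push_cast
    ring
  · funext n
    rw [ModularForm.eta_q_eq_pow]

/-- With x = exp(πiτ), the shift τ ↦ τ + 1 replaces x by -x in η(τ/2). The identity converts the
denominators `RPlus` and `RMinus` into each other under T. -/
lemma eta_half_mul_eta_half {τ : ℂ} (hτ : 0 < τ.im) :
    ModularForm.eta (τ / 2) * ModularForm.eta ((τ + 1) / 2) * ModularForm.eta (2 * τ) =
      cexp (π * I / 24) * ModularForm.eta τ ^ 3 := by
  have hx : ‖cexp (π * I * τ)‖ < 1 := by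
    rw [Complex.norm_exp, Real.exp_lt_one_iff]
    simpa using mul_pos Real.pi_pos hτ
  have key := eulerProd_mul_neg hx
  have e1 : cexp (2 * π * I * (τ / 2)) = cexp (π * I * τ) := by ring_nf
  have e2 : cexp (2 * π * I * ((τ + 1) / 2)) = -cexp (π * I * τ) := by
    rw [show (2 * π * I * ((τ + 1) / 2) : ℂ) = π * I * τ + π * I by ring, Complex.exp_add,
      Complex.exp_pi_mul_I, mul_neg_one]
  have e3 : cexp (2 * π * I * (2 * τ)) = cexp (π * I * τ) ^ 4 := by
    rw [← Complex.exp_nat_mul]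
    push_cast
    ring_nf
  have e4 : cexp (2 * π * I * τ) = cexp (π * I * τ) ^ 2 := by
    rw [← Complex.exp_nat_mul]
    push_cast
    ring_nf
  have hexp : cexp (π * I * (τ / 2) / 12) * cexp (π * I * ((τ + 1) / 2) / 12) *
      cexp (π * I * (2 * τ) / 12) = cexp (π * I / 24) * cexp (π * I * τ / 12) ^ 3 := by
    rw [← Complex.exp_nat_mul, ← Complex.exp_add, ← Complex.exp_add, ← Complex.exp_add]
    push_cast
    ring_nf
  rw [eta_eq_eulerProd, eta_eq_eulerProd, eta_eq_eulerProd, eta_eq_eulerProd τ, e1, e2, e3, e4,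
    mul_pow, ← key]
  linear_combination (eulerProd (cexp (π * I * τ)) * eulerProd (-cexp (π * I * τ)) *
    eulerProd (cexp (π * I * τ) ^ 4)) * hexp

/-! ### Transformations of the denominators -/

lemma eta_ne_zero_of_im_pos {τ : ℂ} (hτ : 0 < τ.im) : ModularForm.eta τ ≠ 0 :=
  ModularForm.eta_ne_zero hτ

lemma ne_zero_of_im_pos {τ : ℂ} (hτ : 0 < τ.im) : τ ≠ 0 := by
  rintro rfl
  simp at hτ

/-- The square root and the Gaussian factor are common to both thetas and cancel. The phase -i comes
from ϑ₁₁ alone. -/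
lemma vartheta_one_one_div_S (a b : ℕ) (hab : a * b = 0) {τ : ℂ} (hτ : 0 < τ.im) (z : ℂ) :
    vartheta 1 1 (-1 / τ) (z / τ) / vartheta a b (-1 / τ) (z / τ) =
      -I * (vartheta 1 1 τ z / vartheta b a τ z) := by
  have hτ0 := ne_zero_of_im_pos hτ
  have hab' : (a : ℂ) * b = 0 := by exact_mod_cast hab
  have hne : (-I * τ) ^ (1 / 2 : ℂ) ≠ 0 := by
    rw [Ne, cpow_eq_zero_iff]
    simp [hτ0]
  have h1 : cexp (-(π * I * (1 : ℕ) * (1 : ℕ)) / 2) = -I := by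
    rw [show (-(π * I * (1 : ℕ) * (1 : ℕ)) / 2 : ℂ) = -(π / 2 * I) by push_cast; ring,
      Complex.exp_neg, Complex.exp_pi_div_two_mul_I, inv_I]
  have h2 : cexp (-(π * I * a * b) / 2) = 1 := by
    rw [mul_assoc _ (a : ℂ), hab']
    simp
  rw [vartheta_S 1 1 hτ0, vartheta_S a b hτ0, h1, h2, mul_one, mul_assoc _ (-I),
    mul_div_mul_left _ _ (mul_ne_zero hne (Complex.exp_ne_zero _)), mul_div_assoc]

/-- The eta factors contribute τ/i and the theta quotient -i, giving -τ. The same count applies to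
`RMinus_S` and `RTw_S`, where the √2 normalising `RTw` absorbs the factor left by the rescaled η. -/
lemma RPlus_S {τ : ℂ} (hτ : 0 < τ.im) (z : ℂ) : RPlus (-1 / τ) (z / τ) = -τ * RPlus τ z := by
  have hτ0 := ne_zero_of_im_pos hτ
  have h1 : (-1 / τ) / 2 = -1 / (((2 : ℝ) : ℂ) * τ) := by
    push_cast
    field_simp
  have h2 : 2 * (-1 / τ) = -1 / (((1 / 2 : ℝ) : ℂ) * τ) := by
    push_cast
    field_simp
  have hs : ((√2 : ℝ) : ℂ) * ((√(1 / 2) : ℝ) : ℂ) = 1 := by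
    rw [← ofReal_mul, ← Real.sqrt_mul zero_le_two]
    norm_num
  have hI := sq_complex_sqrt I
  have hI0 : Complex.sqrt I ≠ 0 := fun h => by simp [h, I_ne_zero.symm] at hI
  have ht := sq_complex_sqrt τ
  rw [RPlus, RPlus, vartheta_one_one_div_S 0 0 rfl hτ, h1, h2, eta_S (by simpa using hτ),
    eta_S (by simpa using hτ), sqrt_ofReal_mul two_pos hτ0, sqrt_ofReal_mul (by norm_num) hτ0]
  have e1 : ((1 / 2 : ℝ) : ℂ) * τ = τ / 2 := by push_cast; ring
  have e2 : ((2 : ℝ) : ℂ) * τ = 2 * τ := by push_cast; ring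
  rw [e1, e2]
  have hII : (Complex.sqrt I)⁻¹ ^ 2 * I = 1 := by
    rw [inv_pow, hI, inv_mul_cancel₀ I_ne_zero]
  generalize vartheta 1 1 τ z / vartheta 0 0 τ z = Q
  linear_combination (-(Complex.sqrt τ ^ 2) * ModularForm.eta (τ / 2) * ModularForm.eta (2 * τ) * Q *
    ((Complex.sqrt I)⁻¹ ^ 2 * I)) * hs +
    (-(Complex.sqrt τ ^ 2) * ModularForm.eta (τ / 2) * ModularForm.eta (2 * τ) * Q) * hII +
    (-ModularForm.eta (τ / 2) * ModularForm.eta (2 * τ) * Q) * ht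

lemma RMinus_S {τ : ℂ} (hτ : 0 < τ.im) (z : ℂ) : RMinus (-1 / τ) (z / τ) = -τ * RTw τ z := by
  have hτ0 := ne_zero_of_im_pos hτ
  have h1 : (-1 / τ) / 2 = -1 / (((2 : ℝ) : ℂ) * τ) := by
    push_cast
    field_simp
  have hs0 : ((√2 : ℝ) : ℂ) ≠ 0 := by simp
  have hI := sq_complex_sqrt I
  have hI0 : Complex.sqrt I ≠ 0 := fun h => by simp [h, I_ne_zero.symm] at hI
  have ht := sq_complex_sqrt τ
  have ht0 : Complex.sqrt τ ≠ 0 := fun h => by simp [h, hτ0.symm] at ht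
  have hη := eta_ne_zero_of_im_pos (τ := 2 * τ) (by simpa using hτ)
  rw [RMinus, RTw, vartheta_one_one_div_S 0 1 rfl hτ, h1, eta_S hτ, eta_S (by simpa using hτ),
    sqrt_ofReal_mul two_pos hτ0]
  have e2 : ((2 : ℝ) : ℂ) * τ = 2 * τ := by push_cast; ring
  rw [e2]
  generalize vartheta 1 1 τ z / vartheta 1 0 τ z = Q
  field_simp
  rw [ht, hI]
  ring

lemma RTw_S {τ : ℂ} (hτ : 0 < τ.im) (z : ℂ) : RTw (-1 / τ) (z / τ) = -τ * RMinus τ z := by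
  have hτ0 := ne_zero_of_im_pos hτ
  have h2 : 2 * (-1 / τ) = -1 / (((1 / 2 : ℝ) : ℂ) * τ) := by
    push_cast
    field_simp
  have hs0 : ((√2 : ℝ) : ℂ) ≠ 0 := by simp
  have hs : ((√2 : ℝ) : ℂ) * ((√(1 / 2) : ℝ) : ℂ) = 1 := by
    rw [← ofReal_mul, ← Real.sqrt_mul zero_le_two]
    norm_num
  have hs' : ((√(1 / 2) : ℝ) : ℂ) = ((√2 : ℝ) : ℂ)⁻¹ := eq_inv_of_mul_eq_one_right hs
  have hI := sq_complex_sqrt I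
  have hI0 : Complex.sqrt I ≠ 0 := fun h => by simp [h, I_ne_zero.symm] at hI
  have ht := sq_complex_sqrt τ
  have ht0 : Complex.sqrt τ ≠ 0 := fun h => by simp [h, hτ0.symm] at ht
  have hη := eta_ne_zero_of_im_pos (τ := τ / 2) (by simpa using hτ)
  rw [RTw, RMinus, vartheta_one_one_div_S 1 0 rfl hτ, h2, eta_S hτ, eta_S (by simpa using hτ),
    sqrt_ofReal_mul (by norm_num) hτ0, hs']
  have e1 : ((1 / 2 : ℝ) : ℂ) * τ = τ / 2 := by push_cast; ring
  rw [e1]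
  generalize vartheta 1 1 τ z / vartheta 0 1 τ z = Q
  field_simp
  rw [ht, hI]
  ring

lemma eta_two_mul_T (τ : ℂ) :
    ModularForm.eta (2 * (τ + 1)) = cexp (π * I / 6) * ModularForm.eta (2 * τ) := by
  rw [show 2 * (τ + 1) = 2 * τ + 1 + 1 by ring, eta_T, eta_T, ← mul_assoc, ← Complex.exp_add]
  ring_nf

lemma RPlus_T {τ : ℂ} (hτ : 0 < τ.im) (z : ℂ) :
    RPlus (τ + 1) z = cexp (11 / 24 * π * I) * RMinus τ z := by
  have hη := eta_ne_zero_of_im_pos (τ := τ / 2) (by simpa using hτ)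
  have key := eta_half_mul_eta_half hτ
  -- The three phases come from the eta product identity, from η(2τ + 2) and from ϑ₁₁.
  have hexp : cexp (11 / 24 * π * I) =
      cexp (π * I / 24) * cexp (π * I / 6) * cexp (π * I / 4) := by
    rw [← Complex.exp_add, ← Complex.exp_add]
    ring_nf
  rw [RPlus, RMinus, eta_two_mul_T, vartheta_one_T, vartheta_zero_zero_T, hexp,
    mul_div_assoc (cexp (π * I / 4))]
  generalize vartheta 1 1 τ z / vartheta 0 1 τ z = Q
  generalize ModularForm.eta (2 * τ) = E at key ⊢
  field_simp
  linear_combination Q * key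

lemma RMinus_T {τ : ℂ} (hτ : 0 < τ.im) (z : ℂ) :
    RMinus (τ + 1) z = cexp (11 / 24 * π * I) * RPlus τ z := by
  have hη := eta_ne_zero_of_im_pos (τ := (τ + 1) / 2) (by simpa using hτ)
  have key := eta_half_mul_eta_half hτ
  have hexp : cexp (11 / 24 * π * I) * cexp (π * I / 24) =
      cexp (π * I / 12) ^ 3 * cexp (π * I / 4) := by
    rw [← Complex.exp_nat_mul, ← Complex.exp_add, ← Complex.exp_add]
    push_cast
    ring_nf
  have h24 := Complex.exp_ne_zero (π * I / 24)
  rw [RPlus, RMinus, eta_T, vartheta_one_T, vartheta_zero_one_T, mul_div_assoc (cexp (π * I / 4))]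
  generalize vartheta 1 1 τ z / vartheta 0 0 τ z = Q
  rw [div_mul_eq_mul_div, div_eq_iff hη]
  refine mul_left_cancel₀ h24 ?_
  linear_combination (-cexp (11 / 24 * π * I) * cexp (π * I / 24) * Q) * key -
    (cexp (π * I / 24) * Q * ModularForm.eta τ ^ 3) * hexp

lemma RTw_T {τ : ℂ} (hτ : 0 < τ.im) (z : ℂ) :
    RTw (τ + 1) z = cexp (π * I / 12) * RTw τ z := by
  have hη := eta_ne_zero_of_im_pos (τ := 2 * τ) (by simpa using hτ)
  have hexp : cexp (π * I / 12) * cexp (π * I / 6) = cexp (π * I / 12) ^ 3 := by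
    rw [← Complex.exp_nat_mul, ← Complex.exp_add]
    push_cast
    ring_nf
  have h4 := Complex.exp_ne_zero (π * I / 4)
  have h6 := Complex.exp_ne_zero (π * I / 6)
  rw [RTw, RTw, eta_T, eta_two_mul_T, vartheta_one_T, vartheta_one_T, mul_div_mul_left _ _ h4,
    mul_pow, ← hexp]
  field_simp

end

end N3

namespace N3

section

open Complex
open scoped Real

/-! ### Weights on the half periods -/

lemma exp_pi_I_mul_eq {x y : ℂ} (n : ℤ) (h : x = y + 2 * n) :
    cexp (π * I * x) = cexp (π * I * y) := by
  rw [Complex.exp_eq_exp_iff_exists_int]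
  exact ⟨n, by rw [h]; ring⟩

lemma exp_pi_I_mul_eq_neg {x y : ℂ} (n : ℤ) (h : x = y + 1 + 2 * n) :
    cexp (π * I * x) = -cexp (π * I * y) := by
  rw [exp_pi_I_mul_eq n h, mul_add, Complex.exp_add, mul_one, Complex.exp_pi_mul_I, mul_neg_one]

lemma charWeight_neg (M k : ℕ) (a₀ c₀ : ℤ) (p : ℤ × ℤ) :
    charWeight M k a₀ c₀ (-p) = charWeight M k a₀ c₀ p := by
  rw [charWeight, charWeight, neg_neg, add_comm (cosetPhase M k a₀ c₀ (-p))]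

lemma charWeight_neg_mk (M k : ℕ) (a₀ c₀ a c : ℤ) :
    charWeight M k a₀ c₀ (-a, -c) = charWeight M k a₀ c₀ (a, c) :=
  charWeight_neg M k a₀ c₀ (a, c)

lemma charWeight_eq_zero {M k : ℕ} {a₀ c₀ a c : ℤ}
    (h1 : ¬ (4 ∣ a - a₀ ∧ 2 ∣ c - c₀)) (h2 : ¬ (4 ∣ -a - a₀ ∧ 2 ∣ -c - c₀)) :
    charWeight M k a₀ c₀ (a, c) = 0 := by
  rw [charWeight, cosetPhase_eq_zero h1, Prod.neg_mk, cosetPhase_eq_zero h2, add_zero, mul_zero]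

lemma charWeight_plus_eq_zero {M k : ℕ} {a c : ℤ} (h : ¬ (Odd a ∧ Odd c)) :
    charWeight M k 1 (-1) (a, c) = 0 :=
  charWeight_eq_zero (by grind) (by grind)

lemma charWeight_minus_eq_zero {M k : ℕ} {a c : ℤ} (h : ¬ (Odd a ∧ Even c)) :
    charWeight M k 1 0 (a, c) = 0 :=
  charWeight_eq_zero (by grind) (by grind)

lemma charWeight_twPlus_eq_zero {M k : ℕ} {a c : ℤ} (h : ¬ (4 ∣ a - 2 ∧ Odd c)) :
    charWeight M k 2 (-1) (a, c) = 0 :=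
  charWeight_eq_zero (by grind) (by grind)

lemma charWeight_twMinus_eq_zero {M k : ℕ} {a c : ℤ} (h : ¬ (4 ∣ a ∧ Odd c)) :
    charWeight M k 0 (-1) (a, c) = 0 :=
  charWeight_eq_zero (by grind) (by grind)

/-- The classes 1 and -1 modulo 4 are disjoint, so only one of the two symmetrised terms
contributes. -/
lemma charWeight_plus_apply (M k : ℕ) (j b : ℤ) : charWeight M k 1 (-1) (1 + 4 * j, -1 + 2 * b) =
    cexp (π * I * (-M / 8 - (k + M * j) * b + M / 4 * (2 * j + b))) := by
  rw [charWeight, cosetPhase_apply, cosetPhase_eq_zero, add_zero, ← Complex.exp_add]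
  · congr 1
    push_cast
    ring
  · simp only [Prod.neg_mk]
    grind

lemma charWeight_minus_apply (M k : ℕ) (j b : ℤ) : charWeight M k 1 0 (1 + 4 * j, 2 * b) =
    cexp (π * I * (-(k + M * j) * b + M / 4 * b)) := by
  have h := cosetPhase_apply M k 1 0 j b
  rw [zero_add] at h
  rw [charWeight, h, cosetPhase_eq_zero, add_zero, ← Complex.exp_add]
  · congr 1
    push_cast
    ring
  · simp only [Prod.neg_mk]
    grind

/-- The coset is stable under negation, (j, b) ↦ (-j, 1 - b), and the two phases differ by exp(πik).
They add up for k = 2 and would cancel for odd k. -/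
lemma charWeight_twMinus_apply (M : ℕ) (j b : ℤ) : charWeight M 2 0 (-1) (4 * j, -1 + 2 * b) =
    2 * cexp (π * I * (-M * j * b + M / 2 * j)) := by
  have h1 := cosetPhase_apply M 2 0 (-1) j b
  have h2 := cosetPhase_apply M 2 0 (-1) (-j) (1 - b)
  rw [zero_add] at h1 h2
  rw [charWeight, h1, Prod.neg_mk, show -(4 * j) = 4 * -j by ring,
    show -(-1 + 2 * b) = -1 + 2 * (1 - b) by ring, h2]
  have e0 : cexp (π * I * M * ((0 : ℤ) * (-1 : ℤ)) / 8) = 1 := by simp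
  have e1 : cexp (-(π * I) * (((2 : ℕ) + M * j) * b + M / 4 * (2 * j * (-1 : ℤ) - b * (0 : ℤ)))) =
      cexp (π * I * (-M * j * b + M / 2 * j)) := by
    rw [neg_mul_comm]
    exact exp_pi_I_mul_eq (-b) (by push_cast; ring)
  have e2 : cexp (-(π * I) * (((2 : ℕ) + M * (-j : ℤ)) * (1 - b : ℤ) +
      M / 4 * (2 * (-j : ℤ) * (-1 : ℤ) - (1 - b : ℤ) * (0 : ℤ)))) =
      cexp (π * I * (-M * j * b + M / 2 * j)) := by
    rw [neg_mul_comm]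
    exact exp_pi_I_mul_eq (b - 1) (by push_cast; ring)
  rw [e0, e1, e2]
  ring

lemma two_dvd_par_add_one_sub (M : ℕ) : ∃ x : ℤ, ((par M + 1 : ℕ) : ℤ) = M + 2 * x := by
  rw [par]
  split_ifs with h
  · obtain ⟨x, hx⟩ := h
    exact ⟨1 - x, by push_cast; lia⟩
  · obtain ⟨x, hx⟩ := Nat.not_even_iff_odd.mp h
    exact ⟨-x, by push_cast; lia⟩

/-- Negation acts on this coset by (j, b) ↦ (-1 - j, 1 - b), and the phases agree exactly when k ≡ M
modulo 2. This is the reason for k = `par M + 1`. -/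
lemma charWeight_twPlus_apply (M : ℕ) (j b : ℤ) :
    charWeight M (par M + 1) 2 (-1) (2 + 4 * j, -1 + 2 * b) =
      2 * cexp (π * I * (-M / 4 - M * j * b + M / 2 * (j - b))) := by
  obtain ⟨x, hx⟩ := two_dvd_par_add_one_sub M
  have hx' : ((par M + 1 : ℕ) : ℂ) = M + 2 * x := by exact_mod_cast hx
  rw [charWeight, cosetPhase_apply, Prod.neg_mk, show -(2 + 4 * j) = 2 + 4 * (-1 - j) by ring,
    show -(-1 + 2 * b) = -1 + 2 * (1 - b) by ring, cosetPhase_apply, mul_add, ← Complex.exp_add,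
    ← Complex.exp_add, hx']
  have e1 : cexp (π * I * M * ((2 : ℤ) * (-1 : ℤ)) / 8 +
      -(π * I) * ((M + 2 * x + M * j) * b + M / 4 * (2 * j * (-1 : ℤ) - b * (2 : ℤ)))) =
      cexp (π * I * (-M / 4 - M * j * b + M / 2 * (j - b))) := by
    rw [← exp_pi_I_mul_eq (x := -M / 4 - ((M + 2 * x + M * j) * b - M / 2 * (j + b))) (-x * b)
      (by push_cast; ring)]
    congr 1
    push_cast
    ring
  have e2 : cexp (π * I * M * ((2 : ℤ) * (-1 : ℤ)) / 8 +
      -(π * I) * ((M + 2 * x + M * (-1 - j : ℤ)) * (1 - b : ℤ) +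
        M / 4 * (2 * (-1 - j : ℤ) * (-1 : ℤ) - (1 - b : ℤ) * (2 : ℤ)))) =
      cexp (π * I * (-M / 4 - M * j * b + M / 2 * (j - b))) := by
    rw [← exp_pi_I_mul_eq (x := -M / 4 - ((2 * x - M * j) * (1 - b) + M / 2 * (j + b))) (-x * (1 - b))
      (by push_cast; ring)]
    congr 1
    push_cast
    ring
  rw [e1, e2]
  ring

lemma weight_ext {c₀ : ℤ} {f g : ℤ × ℤ → ℂ} (hf : ∀ p, f (-p) = f p) (hg : ∀ p, g (-p) = g p)
    (h0 : ∀ a c, ¬ (Odd a ∧ 2 ∣ c - c₀) → f (a, c) = g (a, c))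
    (h : ∀ j b : ℤ, f (1 + 4 * j, c₀ + 2 * b) = g (1 + 4 * j, c₀ + 2 * b)) : f = g := by
  funext ⟨a, c⟩
  by_cases hac : Odd a ∧ 2 ∣ c - c₀
  · obtain ⟨⟨x, hx⟩, y, hy⟩ := hac
    rcases Int.even_or_odd' x with ⟨j, hj | hj⟩
    · have := h j y
      rwa [show (1 + 4 * j, c₀ + 2 * y) = (a, c) from Prod.ext (by dsimp; lia) (by dsimp; lia)]
        at this
    -- Points with a ≡ 3 modulo 4 are negatives of points with a ≡ 1, so evenness reduces to that
    -- class.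
    · have := h (-j - 1) (-y - c₀)
      rw [show (1 + 4 * (-j - 1), c₀ + 2 * (-y - c₀)) = -(a, c) from
        Prod.ext (by dsimp; lia) (by dsimp; lia)] at this
      rwa [hf, hg] at this
  · exact h0 a c hac

/-- For odd a, replacing c by c - a flips the parity of c and so exchanges the supports of the two
untwisted sectors. -/
lemma plusWeight_T (M k : ℕ) :
    (fun p : ℤ × ℤ => charWeight M k 1 (-1) (p.1, p.2 - p.1)) =
      fun p => cexp (-(π * I * M) / 8) * charWeight M k 1 0 p := by
  refine weight_ext (c₀ := 0) (fun p => ?_) (fun p => ?_) (fun a c h => ?_) (fun j b => ?_)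
  · rw [← charWeight_neg]
    congr 1
    ext <;> simp; ring
  · rw [charWeight_neg]
  · dsimp only
    rw [charWeight_plus_eq_zero (by grind), charWeight_minus_eq_zero (by grind), mul_zero]
  · dsimp only
    rw [show 0 + 2 * b - (1 + 4 * j) = -1 + 2 * (b - 2 * j) by ring, zero_add,
      charWeight_plus_apply, charWeight_minus_apply, ← Complex.exp_add]
    rw [exp_pi_I_mul_eq (y := -M / 8 - (k + M * j) * b + M / 4 * b) (k * j + M * j ^ 2)
      (by push_cast; ring)]
    ring_nf

lemma minusWeight_T (M k : ℕ) :
    (fun p : ℤ × ℤ => charWeight M k 1 0 (p.1, p.2 - p.1)) =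
      fun p => cexp (π * I * k) * cexp (-(π * I * M) / 8) * charWeight M k 1 (-1) p := by
  refine weight_ext (c₀ := -1) (fun p => ?_) (fun p => ?_) (fun a c h => ?_) (fun j b => ?_)
  · rw [← charWeight_neg]
    congr 1
    ext <;> simp; ring
  · rw [charWeight_neg]
  · dsimp only
    rw [charWeight_plus_eq_zero (by grind), charWeight_minus_eq_zero (by grind), mul_zero]
  · dsimp only
    rw [show -1 + 2 * b - (1 + 4 * j) = 2 * (b - 1 - 2 * j) by ring,
      charWeight_plus_apply, charWeight_minus_apply, ← Complex.exp_add, ← Complex.exp_add]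
    rw [exp_pi_I_mul_eq (y := k - M / 8 + (-M / 8 - (k + M * j) * b + M / 4 * (2 * j + b)))
      (k * j + M * j ^ 2) (by push_cast; ring)]
    ring_nf

lemma twMinusWeight_T (M : ℕ) :
    (fun p : ℤ × ℤ => charWeight M 2 0 (-1) (p.1, p.2 - p.1)) = charWeight M 2 0 (-1) := by
  funext ⟨a, c⟩
  by_cases h : 4 ∣ a ∧ Odd c
  · obtain ⟨⟨j, rfl⟩, x, rfl⟩ := h
    dsimp only
    rw [show 2 * x + 1 - 4 * j = -1 + 2 * (x + 1 - 2 * j) by ring,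
      show 2 * x + 1 = -1 + 2 * (x + 1) by ring, charWeight_twMinus_apply,
      charWeight_twMinus_apply]
    rw [exp_pi_I_mul_eq (y := -M * j * (x + 1 : ℤ) + M / 2 * j) (M * j ^ 2) (by push_cast; ring)]
  · dsimp only
    rw [charWeight_twMinus_eq_zero h, charWeight_twMinus_eq_zero (by grind)]

lemma twPlusWeight_T (M : ℕ) :
    (fun p : ℤ × ℤ => charWeight M (par M + 1) 2 (-1) (p.1, p.2 - p.1)) =
      fun p => cexp (π * I * M / 2) * charWeight M (par M + 1) 2 (-1) p := by
  funext ⟨a, c⟩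
  by_cases h : 4 ∣ a - 2 ∧ Odd c
  · obtain ⟨⟨j, hj⟩, x, rfl⟩ := h
    obtain rfl : a = 2 + 4 * j := by lia
    dsimp only
    rw [show 2 * x + 1 - (2 + 4 * j) = -1 + 2 * (x - 2 * j) by ring,
      show 2 * x + 1 = -1 + 2 * (x + 1) by ring, charWeight_twPlus_apply,
      charWeight_twPlus_apply, mul_left_comm, ← Complex.exp_add]
    rw [exp_pi_I_mul_eq (y := M / 2 + (-M / 4 - M * j * (x + 1 : ℤ) + M / 2 * (j - (x + 1 : ℤ))))
      (M * j ^ 2 + M * j) (by push_cast; ring)]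
    ring_nf
  · dsimp only
    rw [charWeight_twPlus_eq_zero h, charWeight_twPlus_eq_zero (by grind), mul_zero]

/-- The action of `S` on weights. -/
noncomputable def weightS (φ : ℤ × ℤ → ℂ) (p : ℤ × ℤ) : ℂ := φ (-p.2, p.1)

lemma weightS_neg {φ : ℤ × ℤ → ℂ} (hφ : ∀ p, φ (-p) = φ p) (p : ℤ × ℤ) :
    weightS φ (-p) = weightS φ p := by
  rw [weightS, weightS, ← hφ]
  congr 1
  ext <;> simp

/-- The weights for k = 1 and k = 2 agree at c ≡ 0 modulo 4 and are opposite at c ≡ 2. Their sum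
therefore isolates the class coming from a ≡ 0, and their difference the class from a ≡ 2 used in
`twPlusWeight_S`. -/
lemma twMinusWeight_S (M : ℕ) : weightS (charWeight M 2 0 (-1)) =
    fun p => charWeight M 1 1 0 p + charWeight M 2 1 0 p := by
  refine weight_ext (c₀ := 0) (weightS_neg (charWeight_neg M 2 0 (-1))) (fun p => ?_)
    (fun a c h => ?_) (fun j b => ?_)
  · rw [charWeight_neg, charWeight_neg]
  · dsimp only [weightS]
    rw [charWeight_twMinus_eq_zero (by grind), charWeight_minus_eq_zero (by grind),
      charWeight_minus_eq_zero (by grind), add_zero]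
  · dsimp only [weightS]
    rw [zero_add, charWeight_minus_apply, charWeight_minus_apply]
    rcases Int.even_or_odd' b with ⟨l, rfl | rfl⟩
    · rw [show -(2 * (2 * l)) = 4 * (-l) by ring, show 1 + 4 * j = -1 + 2 * (1 + 2 * j) by ring,
        charWeight_twMinus_apply,
        exp_pi_I_mul_eq (y := M * l / 2) (M * j * l) (by push_cast; ring),
        exp_pi_I_mul_eq (x := -((1 : ℕ) + M * j) * (2 * l : ℤ) + M / 4 * (2 * l : ℤ))
          (y := M * l / 2) (-l - M * j * l) (by push_cast; ring),
        exp_pi_I_mul_eq (x := -((2 : ℕ) + M * j) * (2 * l : ℤ) + M / 4 * (2 * l : ℤ))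
          (y := M * l / 2) (-2 * l - M * j * l) (by push_cast; ring)]
      ring
    · rw [charWeight_twMinus_eq_zero (by grind),
        exp_pi_I_mul_eq_neg (x := -((1 : ℕ) + M * j) * (2 * l + 1 : ℤ) + M / 4 * (2 * l + 1 : ℤ))
          (y := -((2 : ℕ) + M * j) * (2 * l + 1 : ℤ) + M / 4 * (2 * l + 1 : ℤ)) l
          (by push_cast; ring)]
      ring

lemma twPlusWeight_S (M : ℕ) : weightS (charWeight M (par M + 1) 2 (-1)) =
    fun p => cexp (-(π * I * M) / 2) * (charWeight M 2 1 0 p - charWeight M 1 1 0 p) := by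
  refine weight_ext (c₀ := 0) (weightS_neg (charWeight_neg M _ 2 (-1))) (fun p => ?_)
    (fun a c h => ?_) (fun j b => ?_)
  · rw [charWeight_neg, charWeight_neg]
  · dsimp only [weightS]
    rw [charWeight_twPlus_eq_zero (by grind), charWeight_minus_eq_zero (by grind),
      charWeight_minus_eq_zero (by grind), sub_zero, mul_zero]
  · dsimp only [weightS]
    rw [zero_add, charWeight_minus_apply, charWeight_minus_apply]
    rcases Int.even_or_odd' b with ⟨l, rfl | rfl⟩
    · rw [charWeight_twPlus_eq_zero (by grind),
        exp_pi_I_mul_eq (x := -((1 : ℕ) + M * j) * (2 * l : ℤ) + M / 4 * (2 * l : ℤ))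
          (y := -((2 : ℕ) + M * j) * (2 * l : ℤ) + M / 4 * (2 * l : ℤ)) l
          (by push_cast; ring)]
      ring
    · rw [show -(2 * (2 * l + 1)) = 2 + 4 * (-l - 1) by ring,
        show 1 + 4 * j = -1 + 2 * (1 + 2 * j) by ring, charWeight_twPlus_apply,
        exp_pi_I_mul_eq_neg (x := -((1 : ℕ) + M * j) * (2 * l + 1 : ℤ) + M / 4 * (2 * l + 1 : ℤ))
          (y := -((2 : ℕ) + M * j) * (2 * l + 1 : ℤ) + M / 4 * (2 * l + 1 : ℤ)) l
          (by push_cast; ring), sub_neg_eq_add, ← two_mul, mul_left_comm, ← Complex.exp_add,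
        exp_pi_I_mul_eq (y := -M / 2 + (-((2 : ℕ) + M * j) * (2 * l + 1 : ℤ) +
          M / 4 * (2 * l + 1 : ℤ))) (2 * l + 1 + 2 * M * j * l + M * j) (by push_cast; ring)]
      ring_nf

end

end N3

namespace N3

section

open Complex
open scoped Real

/-- The image is supported on even a and odd c. The classes a ≡ 0 and a ≡ 2 modulo 4 are the two
twisted sectors, and the factor 1/2 compensates their doubled phases. The value of k matters only on
the second class, through exp(πik). -/
lemma minusWeight_S (M : ℕ) (k : ℕ) : weightS (charWeight M k 1 0) =
    fun p => 1 / 2 * (charWeight M 2 0 (-1) p +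
      cexp (π * I * k) * cexp (π * I * M / 2) * charWeight M (par M + 1) 2 (-1) p) := by
  funext ⟨a, c⟩
  by_cases h : Even a ∧ Odd c
  · obtain ⟨⟨x, hx⟩, y, hy⟩ := h
    obtain rfl : c = -1 + 2 * (y + 1) := by lia
    generalize y + 1 = b
    -- The new first coordinate is -c = 1 - 2b. It is 1 modulo 4 for even b, while for odd b
    -- evenness of the weight is needed to return to that class.
    have hneg : ∀ l : ℤ, weightS (charWeight M k 1 0) (a, -1 + 2 * (2 * l + 1)) =
        charWeight M k 1 0 (1 + 4 * l, 2 * -x) := fun l => by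
      rw [← charWeight_neg_mk, weightS]
      congr 2 <;> dsimp only <;> lia
    have hpos : ∀ l : ℤ, weightS (charWeight M k 1 0) (a, -1 + 2 * (2 * l)) =
        charWeight M k 1 0 (1 + 4 * -l, 2 * x) := fun l => by
      rw [weightS]
      congr 2 <;> dsimp only <;> lia
    rcases Int.even_or_odd' x with ⟨j, hj | hj⟩
    · obtain rfl : a = 4 * j := by lia
      rw [charWeight_twPlus_eq_zero (by grind), charWeight_twMinus_apply]
      rcases Int.even_or_odd' b with ⟨l, rfl | rfl⟩
      · rw [hpos, hj, charWeight_minus_apply,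
          exp_pi_I_mul_eq (y := -M * j * (2 * l : ℤ) + M / 2 * j) (-k * j + 2 * M * j * l)
            (by push_cast; ring)]
        ring
      · rw [hneg, hj, charWeight_minus_apply,
          exp_pi_I_mul_eq (y := -M * j * (2 * l + 1 : ℤ) + M / 2 * j) (k * j + 2 * M * j * l)
            (by push_cast; ring)]
        ring
    · obtain rfl : a = 2 + 4 * j := by lia
      rw [charWeight_twMinus_eq_zero (by grind), charWeight_twPlus_apply, zero_add,
        mul_left_comm _ (2 : ℂ), ← mul_assoc, ← Complex.exp_add, ← Complex.exp_add]
      rcases Int.even_or_odd' b with ⟨l, rfl | rfl⟩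
      · rw [hpos, hj, charWeight_minus_apply,
          exp_pi_I_mul_eq (y := k + M / 2 + (-M / 4 - M * j * (2 * l : ℤ) +
            M / 2 * (j - (2 * l : ℤ)))) (-k - k * j + M * l + 2 * M * j * l)
            (by push_cast; ring)]
        ring_nf
      · rw [hneg, hj, charWeight_minus_apply,
          exp_pi_I_mul_eq (y := k + M / 2 + (-M / 4 - M * j * (2 * l + 1 : ℤ) +
            M / 2 * (j - (2 * l + 1 : ℤ)))) (k * j + M * l + 2 * M * j * l)
            (by push_cast; ring)]
        ring_nf
  · rw [weightS, charWeight_minus_eq_zero (by grind), charWeight_twMinus_eq_zero (by grind),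
      charWeight_twPlus_eq_zero (by grind)]
    ring

/-- On this coset S multiplies the k = 2 weight by one constant for even b and another for odd b.
The k = 1 weight is (-1)^b times the k = 2 weight, so `plusWeight_S` expresses the result by the
half sum and half difference of these constants. -/
lemma plusWeight_S_even (M k : ℕ) (j l : ℤ) :
    weightS (charWeight M k 1 (-1)) (1 + 4 * j, -1 + 2 * (2 * l)) =
      cexp (π * I * (k + M / 4)) * charWeight M 2 1 (-1) (1 + 4 * j, -1 + 2 * (2 * l)) := by
  rw [weightS]
  dsimp only
  rw [show -(-1 + 2 * (2 * l)) = 1 + 4 * -l by ring, show 1 + 4 * j = -1 + 2 * (1 + 2 * j) by ring,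
    charWeight_plus_apply, show -1 + 2 * (1 + 2 * j) = 1 + 4 * j by ring, charWeight_plus_apply,
    ← Complex.exp_add, exp_pi_I_mul_eq (y := k + M / 4 + (-M / 8 - ((2 : ℕ) + M * j) * (2 * l : ℤ) +
      M / 4 * (2 * j + (2 * l : ℤ)))) (-k - k * j + 2 * l + 2 * M * j * l)
      (by push_cast; ring)]
  ring_nf

lemma plusWeight_S_odd (M k : ℕ) (j l : ℤ) :
    weightS (charWeight M k 1 (-1)) (1 + 4 * j, -1 + 2 * (2 * l + 1)) =
      cexp (π * I * (-M / 4)) * charWeight M 2 1 (-1) (1 + 4 * j, -1 + 2 * (2 * l + 1)) := by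
  rw [weightS]
  dsimp only
  rw [← charWeight_neg_mk, show -(-(-1 + 2 * (2 * l + 1))) = 1 + 4 * l by ring,
    show -(1 + 4 * j) = -1 + 2 * (-2 * j) by ring,
    charWeight_plus_apply, charWeight_plus_apply, ← Complex.exp_add,
    exp_pi_I_mul_eq (y := -M / 4 + (-M / 8 - ((2 : ℕ) + M * j) * (2 * l + 1 : ℤ) +
      M / 4 * (2 * j + (2 * l + 1 : ℤ)))) (k * j + 2 * l + 1 + 2 * M * j * l)
      (by push_cast; ring)]
  ring_nf

lemma charWeight_plus_one_even (M : ℕ) (j l : ℤ) :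
    charWeight M 1 1 (-1) (1 + 4 * j, -1 + 2 * (2 * l)) =
      charWeight M 2 1 (-1) (1 + 4 * j, -1 + 2 * (2 * l)) := by
  rw [charWeight_plus_apply, charWeight_plus_apply]
  exact exp_pi_I_mul_eq l (by push_cast; ring)

lemma charWeight_plus_one_odd (M : ℕ) (j l : ℤ) :
    charWeight M 1 1 (-1) (1 + 4 * j, -1 + 2 * (2 * l + 1)) =
      -charWeight M 2 1 (-1) (1 + 4 * j, -1 + 2 * (2 * l + 1)) := by
  rw [charWeight_plus_apply, charWeight_plus_apply]
  exact exp_pi_I_mul_eq_neg l (by push_cast; ring)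

lemma exp_quarter_relations (M : ℕ) :
    cexp (π * I * (-M / 4)) = (cexp (π * I * (M / 4)))⁻¹ ∧
    cexp (-(π * I * M) / 4) = (cexp (π * I * (M / 4)))⁻¹ ∧
    cexp (π * I * M / 2) = cexp (π * I * (M / 4)) ^ 2 := by
  refine ⟨?_, ?_, ?_⟩
  · rw [← Complex.exp_neg]; ring_nf
  · rw [← Complex.exp_neg]; ring_nf
  · rw [← Complex.exp_nat_mul]; push_cast; ring_nf

/-- With `ε = exp (πik)`, covers both `k = 1` and `k = 2`. -/
lemma plusWeight_S (M k : ℕ) : weightS (charWeight M k 1 (-1)) =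
    fun p => 1 / 2 * cexp (-(π * I * M) / 4) *
      ((1 + cexp (π * I * k) * cexp (π * I * M / 2)) * charWeight M 2 1 (-1) p +
        (cexp (π * I * k) * cexp (π * I * M / 2) - 1) * charWeight M 1 1 (-1) p) := by
  obtain ⟨h1, h2, h3⟩ := exp_quarter_relations M
  have hX := Complex.exp_ne_zero (π * I * (M / 4))
  refine weight_ext (c₀ := -1) (weightS_neg (charWeight_neg M k 1 (-1))) (fun p => ?_)
    (fun a c h => ?_) (fun j b => ?_)
  · rw [charWeight_neg, charWeight_neg]
  · rw [weightS, charWeight_plus_eq_zero (by grind), charWeight_plus_eq_zero (by grind),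
      charWeight_plus_eq_zero (by grind)]
    ring
  · rcases Int.even_or_odd' b with ⟨l, rfl | rfl⟩
    · rw [plusWeight_S_even, charWeight_plus_one_even, mul_add, Complex.exp_add, h2, h3]
      field_simp
      ring
    · rw [plusWeight_S_odd, charWeight_plus_one_odd, h1, h2, h3]
      field_simp
      ring

/-! ### Transformations of the characters -/

lemma latticeSum_linear {M : ℕ} (hM : 0 < M) {τ : ℂ} (hτ : 0 < τ.im) (z a b : ℂ)
    {φ ψ : ℤ × ℤ → ℂ} (hφ : ∃ C, ∀ p, ‖φ p‖ ≤ C) (hψ : ∃ C, ∀ p, ‖ψ p‖ ≤ C) :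
    latticeSum M (fun p => a * φ p + b * ψ p) τ z =
      a * latticeSum M φ τ z + b * latticeSum M ψ τ z := by
  obtain ⟨C, hC⟩ := hφ
  obtain ⟨D, hD⟩ := hψ
  rw [latticeSum_add hM hτ z (C := ‖a‖ * C) (D := ‖b‖ * D), latticeSum_const_mul,
    latticeSum_const_mul]
  · intro p
    rw [norm_mul]
    exact mul_le_mul_of_nonneg_left (hC p) (norm_nonneg _)
  · intro p
    rw [norm_mul]
    exact mul_le_mul_of_nonneg_left (hD p) (norm_nonneg _)

lemma im_neg_one_div_pos {τ : ℂ} (hτ : 0 < τ.im) : 0 < (-1 / τ).im := by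
  have := Complex.normSq_pos.mpr (ne_zero_of_im_pos hτ)
  rw [neg_div, one_div, neg_im, inv_im, neg_div, neg_neg]
  positivity

lemma vartheta_S_ne_zero {a b : ℕ} {τ z : ℂ} (hτ : 0 < τ.im) (h : vartheta b a τ z ≠ 0) :
    vartheta a b (-1 / τ) (z / τ) ≠ 0 := by
  have hτ0 := ne_zero_of_im_pos hτ
  rw [vartheta_S a b hτ0]
  refine mul_ne_zero (mul_ne_zero (mul_ne_zero ?_ (Complex.exp_ne_zero _))
    (Complex.exp_ne_zero _)) h
  rw [Ne, cpow_eq_zero_iff]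
  simp [hτ0]

lemma latticeSum_weightS (M : ℕ) (φ : ℤ × ℤ → ℂ) {τ : ℂ} (hτ : 0 < τ.im) (z : ℂ) :
    latticeSum M φ (-1 / τ) (z / τ) = τ * cexp (π * I * M * z ^ 2 / (2 * τ)) *
      latticeSum M (weightS φ) τ z := latticeSum_S M φ hτ z

/-- The τ from the lattice sum cancels the -τ from the denominator, leaving weight zero and an
overall minus sign. -/
lemma mul_mul_div_neg_mul {τ : ℂ} (hτ : τ ≠ 0) (a G x R : ℂ) :
    a * (τ * G * x) / (-τ * R) = -(G * (a * x / R)) := by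
  rw [neg_mul, div_neg, show a * (τ * G * x) = τ * (G * (a * x)) by ring,
    mul_div_mul_left _ _ hτ, mul_div_assoc]

lemma exp_pi_I_mul_one : cexp (π * I * (1 : ℕ)) = -1 := by
  rw [Nat.cast_one, mul_one, Complex.exp_pi_mul_I]

lemma exp_pi_I_mul_two : cexp (π * I * (2 : ℕ)) = 1 := by
  rw [Complex.exp_eq_one_iff]
  exact ⟨1, by push_cast; ring⟩

lemma chPlus_S {M : ℕ} (hM : 0 < M) (m₂ : ℕ) {τ z : ℂ} (hτ : 0 < τ.im)
    (h : vartheta 0 0 τ z ≠ 0) : chPlus M m₂ (-1 / τ) (z / τ) =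
      -(1 / 2) * cexp (-(π * I * M) / 4) * cexp (π * I * M * z ^ 2 / (2 * τ)) *
        ((1 + cexp (π * I * (m₂ + 1 : ℕ)) * cexp (π * I * M / 2)) * chPlus M 1 τ z +
          (cexp (π * I * (m₂ + 1 : ℕ)) * cexp (π * I * M / 2) - 1) * chPlus M 0 τ z) := by
  have hτ0 := ne_zero_of_im_pos hτ
  rw [chPlus_eq hM m₂ (im_neg_one_div_pos hτ) (vartheta_S_ne_zero hτ h), chPlus_eq hM 1 hτ h,
    chPlus_eq hM 0 hτ h, RPlus_S hτ, latticeSum_weightS M _ hτ, plusWeight_S, latticeSum_const_mul,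
    latticeSum_linear hM hτ z _ _ (exists_norm_charWeight_le M _ _ _)
      (exists_norm_charWeight_le M _ _ _), mul_mul_div_neg_mul hτ0]
  ring

lemma chMinus_S {M : ℕ} (hM : 0 < M) (m₂ : ℕ) {τ z : ℂ} (hτ : 0 < τ.im)
    (h : vartheta 1 0 τ z ≠ 0) : chMinus M m₂ (-1 / τ) (z / τ) =
      -(1 / 2) * cexp (π * I * M * z ^ 2 / (2 * τ)) * (chTwMinus M 1 τ z +
        cexp (π * I * (m₂ + 1 : ℕ)) * cexp (π * I * M / 2) * chTwPlus M (par M) τ z) := by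
  have hτ0 := ne_zero_of_im_pos hτ
  have hw : weightS (charWeight M (m₂ + 1) 1 0) = fun p => 1 / 2 * charWeight M (1 + 1) 0 (-1) p +
      1 / 2 * (cexp (π * I * (m₂ + 1 : ℕ)) * cexp (π * I * M / 2)) *
        charWeight M (par M + 1) 2 (-1) p := by
    rw [minusWeight_S]
    funext p
    ring
  rw [chMinus_eq hM m₂ (im_neg_one_div_pos hτ) (vartheta_S_ne_zero hτ h), chTwMinus_eq hM 1 hτ h,
    chTwPlus_eq hM (par M) hτ h, RMinus_S hτ, latticeSum_weightS M _ hτ, hw,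
    latticeSum_linear hM hτ z _ _ (exists_norm_charWeight_le M _ _ _)
      (exists_norm_charWeight_le M _ _ _), mul_mul_div_neg_mul hτ0]
  ring

lemma chTwPlus_S {M : ℕ} (hM : 0 < M) {τ z : ℂ} (hτ : 0 < τ.im)
    (h : vartheta 0 1 τ z ≠ 0) : chTwPlus M (par M) (-1 / τ) (z / τ) =
      cexp (-(π * I * M) / 2) * cexp (π * I * M * z ^ 2 / (2 * τ)) *
        (chMinus M 0 τ z - chMinus M 1 τ z) := by
  have hτ0 := ne_zero_of_im_pos hτ
  have hw : weightS (charWeight M (par M + 1) 2 (-1)) = fun p =>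
      cexp (-(π * I * M) / 2) * charWeight M (1 + 1) 1 0 p +
        -cexp (-(π * I * M) / 2) * charWeight M (0 + 1) 1 0 p := by
    rw [twPlusWeight_S]
    funext p
    ring
  rw [chTwPlus_eq hM _ (im_neg_one_div_pos hτ) (vartheta_S_ne_zero hτ h), chMinus_eq hM 1 hτ h,
    chMinus_eq hM 0 hτ h, RTw_S hτ, latticeSum_weightS M _ hτ, hw,
    latticeSum_linear hM hτ z _ _ (exists_norm_charWeight_le M _ _ _)
      (exists_norm_charWeight_le M _ _ _), mul_mul_div_neg_mul hτ0]
  ring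

lemma chTwMinus_S {M : ℕ} (hM : 0 < M) {τ z : ℂ} (hτ : 0 < τ.im)
    (h : vartheta 0 1 τ z ≠ 0) : chTwMinus M 1 (-1 / τ) (z / τ) =
      -cexp (π * I * M * z ^ 2 / (2 * τ)) * (chMinus M 0 τ z + chMinus M 1 τ z) := by
  have hτ0 := ne_zero_of_im_pos hτ
  have hw : weightS (charWeight M (1 + 1) 0 (-1)) = fun p =>
      1 * charWeight M (1 + 1) 1 0 p + 1 * charWeight M (0 + 1) 1 0 p := by
    rw [twMinusWeight_S]
    funext p
    ring
  rw [chTwMinus_eq hM _ (im_neg_one_div_pos hτ) (vartheta_S_ne_zero hτ h), chMinus_eq hM 1 hτ h,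
    chMinus_eq hM 0 hτ h, RTw_S hτ, latticeSum_weightS M _ hτ, hw,
    latticeSum_linear hM hτ z _ _ (exists_norm_charWeight_le M _ _ _)
      (exists_norm_charWeight_le M _ _ _), mul_mul_div_neg_mul hτ0]
  ring

lemma im_add_one_pos {τ : ℂ} (hτ : 0 < τ.im) : 0 < (τ + 1).im := by simpa using hτ

lemma exp_multiplier (M : ℕ) : cexp (-((M : ℂ) / 8 + 11 / 24) * π * I) =
    cexp (-(π * I * M) / 8) * (cexp (11 / 24 * π * I))⁻¹ := by
  rw [← Complex.exp_neg, ← Complex.exp_add]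
  ring_nf

lemma chPlus_T {M : ℕ} (hM : 0 < M) (m₂ : ℕ) {τ z : ℂ} (hτ : 0 < τ.im)
    (h : vartheta 0 1 τ z ≠ 0) : chPlus M m₂ (τ + 1) z =
      cexp (-((M : ℂ) / 8 + 11 / 24) * π * I) * chMinus M m₂ τ z := by
  rw [chPlus_eq hM m₂ (im_add_one_pos hτ) (by rwa [vartheta_zero_zero_T]), chMinus_eq hM m₂ hτ h,
    RPlus_T hτ, latticeSum_T, plusWeight_T, latticeSum_const_mul, exp_multiplier, div_eq_mul_inv,
    div_eq_mul_inv, mul_inv]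
  ring

lemma chMinus_T {M : ℕ} (hM : 0 < M) (m₂ : ℕ) {τ z : ℂ} (hτ : 0 < τ.im)
    (h : vartheta 0 0 τ z ≠ 0) : chMinus M m₂ (τ + 1) z =
      cexp (π * I * (m₂ + 1 : ℕ)) * cexp (-((M : ℂ) / 8 + 11 / 24) * π * I) *
        chPlus M m₂ τ z := by
  rw [chMinus_eq hM m₂ (im_add_one_pos hτ) (by rwa [vartheta_zero_one_T]), chPlus_eq hM m₂ hτ h,
    RMinus_T hτ, latticeSum_T, minusWeight_T, latticeSum_const_mul, exp_multiplier, div_eq_mul_inv,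
    div_eq_mul_inv, mul_inv]
  ring

lemma chTwPlus_T {M : ℕ} (hM : 0 < M) {τ z : ℂ} (hτ : 0 < τ.im)
    (h : vartheta 1 0 τ z ≠ 0) : chTwPlus M (par M) (τ + 1) z =
      cexp (((M : ℂ) / 2 - 1 / 12) * π * I) * chTwPlus M (par M) τ z := by
  have hexp : cexp (((M : ℂ) / 2 - 1 / 12) * π * I) =
      cexp (π * I * M / 2) * (cexp (π * I / 12))⁻¹ := by
    rw [← Complex.exp_neg, ← Complex.exp_add]
    ring_nf
  rw [chTwPlus_eq hM _ (im_add_one_pos hτ) (by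
      rw [vartheta_one_T]
      exact mul_ne_zero (Complex.exp_ne_zero _) h), chTwPlus_eq hM _ hτ h,
    RTw_T hτ, latticeSum_T, twPlusWeight_T, latticeSum_const_mul, hexp, div_eq_mul_inv,
    div_eq_mul_inv, mul_inv]
  ring

lemma chTwMinus_T {M : ℕ} (hM : 0 < M) {τ z : ℂ} (hτ : 0 < τ.im)
    (h : vartheta 1 0 τ z ≠ 0) : chTwMinus M 1 (τ + 1) z =
      cexp (-(π * I) / 12) * chTwMinus M 1 τ z := by
  have hexp : cexp (-(π * I) / 12) = (cexp (π * I / 12))⁻¹ := by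
    rw [← Complex.exp_neg]
    ring_nf
  rw [chTwMinus_eq hM _ (im_add_one_pos hτ) (by
      rw [vartheta_one_T]
      exact mul_ne_zero (Complex.exp_ne_zero _) h), chTwMinus_eq hM _ hτ h,
    RTw_T hτ, latticeSum_T, twMinusWeight_T, hexp, div_eq_mul_inv,
    div_eq_mul_inv, mul_inv]
  ring

end

end N3

namespace N3

section

open Complex
open scoped Real

/-! ### Closure under the modular group -/

/-- The points at which all six characters are given by their formulas. -/
def AllRegular (τ : ℍ) (z : ℂ) : Prop := Regular 0 0 τ z ∧ Regular 0 1 τ z ∧ Regular 1 0 τ z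

/-- The automorphy factor `cτ + d`. -/
noncomputable def autFactor (γ : SL(2, ℤ)) (τ : ℍ) : ℂ := (γ 1 0 : ℤ) * (τ : ℂ) + (γ 1 1 : ℤ)

lemma coe_smul_eq (γ : SL(2, ℤ)) (τ : ℍ) :
    ((γ • τ : ℍ) : ℂ) = ((γ 0 0 : ℤ) * (τ : ℂ) + (γ 0 1 : ℤ)) / autFactor γ τ := by
  rw [UpperHalfPlane.coe_specialLinearGroup_apply, autFactor]
  simp

lemma autFactor_ne_zero (γ : SL(2, ℤ)) (τ : ℍ) : autFactor γ τ ≠ 0 := by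
  intro h
  have h1 := (γ • τ).im_pos
  rw [← UpperHalfPlane.coe_im, coe_smul_eq, h, div_zero, zero_im] at h1
  exact lt_irrefl _ h1

lemma autFactor_mul (γ₁ γ₂ : SL(2, ℤ)) (τ : ℍ) :
    autFactor (γ₁ * γ₂) τ = autFactor γ₁ (γ₂ • τ) * autFactor γ₂ τ := by
  have h := autFactor_ne_zero γ₂ τ
  rw [autFactor, autFactor, coe_smul_eq]
  field_simp
  simp only [autFactor, Matrix.SpecialLinearGroup.coe_mul, Matrix.mul_apply, Fin.sum_univ_two]
  push_cast
  ring

lemma slash_apply (m : ℕ) (γ : SL(2, ℤ)) (F : ℍ → ℂ → ℂ) (τ : ℍ) (z : ℂ) :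
    slash m γ F τ z = cexp (-(π * I * m * (γ 1 0 : ℤ) * z ^ 2) / (2 * autFactor γ τ)) *
      F (γ • τ) (z / autFactor γ τ) := rfl

lemma slash_mul (m : ℕ) (γ₁ γ₂ : SL(2, ℤ)) (F : ℍ → ℂ → ℂ) :
    slash m (γ₁ * γ₂) F = slash m γ₂ (slash m γ₁ F) := by
  funext τ z
  have h1 := autFactor_ne_zero γ₁ (γ₂ • τ)
  have h2 := autFactor_ne_zero γ₂ τ
  have hdet : (γ₂ 0 0 : ℂ) * γ₂ 1 1 - γ₂ 0 1 * γ₂ 1 0 = 1 := by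
    have := γ₂.det_coe
    rw [Matrix.det_fin_two] at this
    exact_mod_cast this
  -- This relation between lower-left entries, a consequence of det γ₂ = 1, splits the index
  -- exponent of the product into the exponents of its factors.
  have hcoc : (((γ₁ * γ₂) 1 0 : ℤ) : ℂ) * autFactor γ₂ τ =
      (γ₁ 1 0 : ℤ) + (γ₂ 1 0 : ℤ) * (autFactor γ₁ (γ₂ • τ) * autFactor γ₂ τ) := by
    rw [← autFactor_mul]
    simp only [autFactor, Matrix.SpecialLinearGroup.coe_mul, Matrix.mul_apply, Fin.sum_univ_two]
    push_cast
    linear_combination (γ₁ 1 0 : ℂ) * hdet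
  have hexp : ∀ a b c c₁ c₂ : ℂ, a ≠ 0 → b ≠ 0 → c * b = c₁ + c₂ * (a * b) →
      -(π * I * m * c * z ^ 2) / (2 * (a * b)) =
        -(π * I * m * c₂ * z ^ 2) / (2 * b) + -(π * I * m * c₁ * (z / b) ^ 2) / (2 * a) := by
    intro a b c c₁ c₂ ha hb h
    rw [show c = c₁ / b + c₂ * a by field_simp; linear_combination h]
    field_simp
    ring
  rw [slash_apply, slash_apply, slash_apply, autFactor_mul, mul_smul,
    hexp _ _ _ _ _ h1 h2 hcoc, Complex.exp_add, mul_assoc, div_div, mul_comm (autFactor γ₂ τ)]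

lemma slash_add (m : ℕ) (γ : SL(2, ℤ)) (F G : ℍ → ℂ → ℂ) :
    slash m γ (F + G) = slash m γ F + slash m γ G := by
  funext τ z
  simp only [slash_apply, Pi.add_apply, mul_add]

lemma slash_smul (m : ℕ) (γ : SL(2, ℤ)) (a : ℂ) (F : ℍ → ℂ → ℂ) :
    slash m γ (a • F) = a • slash m γ F := by
  funext τ z
  simp only [slash_apply, Pi.smul_apply, smul_eq_mul, mul_left_comm]

/-- `γ` preserves the regular points and the span of the characters. -/
def PreservesCharSpace (m : ℕ) (γ : SL(2, ℤ)) : Prop :=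
  (∀ τ z, AllRegular τ z → AllRegular (γ • τ) (z / autFactor γ τ)) ∧
    ∀ F ∈ charSpace m, ∃ G ∈ charSpace m, ∀ τ z, AllRegular τ z → slash m γ F τ z = G τ z

lemma PreservesCharSpace.mul {m : ℕ} {γ₁ γ₂ : SL(2, ℤ)} (h₁ : PreservesCharSpace m γ₁)
    (h₂ : PreservesCharSpace m γ₂) : PreservesCharSpace m (γ₁ * γ₂) := by
  refine ⟨fun τ z h => ?_, fun F hF => ?_⟩
  · rw [mul_smul, autFactor_mul, mul_comm, ← div_div]
    exact h₁.1 _ _ (h₂.1 τ z h)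
  · obtain ⟨G₁, hG₁, e₁⟩ := h₁.2 F hF
    obtain ⟨G₂, hG₂, e₂⟩ := h₂.2 G₁ hG₁
    refine ⟨G₂, hG₂, fun τ z h => ?_⟩
    -- Equality with G₁ holds only at regular points, so the transformed point must be regular too.
    rw [slash_mul, ← e₂ τ z h, slash_apply, e₁ _ _ (h₂.1 τ z h), ← slash_apply]

lemma slash_span_closed {m : ℕ} {γ : SL(2, ℤ)} {s : Set (ℍ → ℂ → ℂ)}
    {V : Submodule ℂ (ℍ → ℂ → ℂ)}
    (h : ∀ F ∈ s, ∃ G ∈ V, ∀ τ z, AllRegular τ z → slash m γ F τ z = G τ z) :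
    ∀ F ∈ Submodule.span ℂ s, ∃ G ∈ V, ∀ τ z, AllRegular τ z → slash m γ F τ z = G τ z := by
  intro F hF
  induction hF using Submodule.span_induction with
  | mem F hF => exact h F hF
  | zero => exact ⟨0, V.zero_mem, fun τ z _ => by simp [slash_apply]⟩
  | add F₁ F₂ _ _ h₁ h₂ =>
    obtain ⟨G₁, hG₁, e₁⟩ := h₁
    obtain ⟨G₂, hG₂, e₂⟩ := h₂
    refine ⟨G₁ + G₂, V.add_mem hG₁ hG₂, fun τ z hz => ?_⟩
    rw [slash_add, Pi.add_apply, Pi.add_apply, e₁ τ z hz, e₂ τ z hz]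
    rfl
  | smul a F _ h =>
    obtain ⟨G, hG, e⟩ := h
    refine ⟨a • G, V.smul_mem a hG, fun τ z hz => ?_⟩
    rw [slash_smul, Pi.smul_apply, Pi.smul_apply, e τ z hz]
    rfl

lemma chPlus_zero_mem (m : ℕ) :
    (fun (τ : ℍ) z => chPlus m 0 τ z : ℍ → ℂ → ℂ) ∈ charSpace m :=
  Submodule.subset_span (by simp)

lemma chPlus_one_mem (m : ℕ) :
    (fun (τ : ℍ) z => chPlus m 1 τ z : ℍ → ℂ → ℂ) ∈ charSpace m :=
  Submodule.subset_span (by simp)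

lemma chMinus_zero_mem (m : ℕ) :
    (fun (τ : ℍ) z => chMinus m 0 τ z : ℍ → ℂ → ℂ) ∈ charSpace m :=
  Submodule.subset_span (by simp)

lemma chMinus_one_mem (m : ℕ) :
    (fun (τ : ℍ) z => chMinus m 1 τ z : ℍ → ℂ → ℂ) ∈ charSpace m :=
  Submodule.subset_span (by simp)

lemma chTwPlus_mem (m : ℕ) :
    (fun (τ : ℍ) z => chTwPlus m (par m) τ z : ℍ → ℂ → ℂ) ∈ charSpace m :=
  Submodule.subset_span (by simp)

lemma chTwMinus_mem (m : ℕ) :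
    (fun (τ : ℍ) z => chTwMinus m 1 τ z : ℍ → ℂ → ℂ) ∈ charSpace m :=
  Submodule.subset_span (by simp)

lemma slash_S (m : ℕ) (F : ℂ → ℂ → ℂ) (τ : ℍ) (z : ℂ) :
    slash m ModularGroup.S (fun τ z => F τ z) τ z =
      (cexp (π * I * m * z ^ 2 / (2 * τ)))⁻¹ * F (-1 / (τ : ℂ)) (z / τ) := by
  have hj : autFactor ModularGroup.S τ = τ := by simp [autFactor, ModularGroup.S]
  have hS : ((ModularGroup.S • τ : ℍ) : ℂ) = -1 / τ := by
    rw [coe_smul_eq, hj]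
    simp [ModularGroup.S]
  have hc : ((ModularGroup.S 1 0 : ℤ) : ℂ) = 1 := by simp [ModularGroup.S]
  rw [slash_apply, hj, hS, hc, ← Complex.exp_neg]
  ring_nf

lemma slash_T (m : ℕ) (F : ℂ → ℂ → ℂ) (τ : ℍ) (z : ℂ) :
    slash m ModularGroup.T (fun τ z => F τ z) τ z = F ((τ : ℂ) + 1) z := by
  have hj : autFactor ModularGroup.T τ = 1 := by simp [autFactor, ModularGroup.T]
  have hT : ((ModularGroup.T • τ : ℍ) : ℂ) = τ + 1 := by
    rw [coe_smul_eq, hj]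
    simp [ModularGroup.T]
  have hc : ((ModularGroup.T 1 0 : ℤ) : ℂ) = 0 := by simp [ModularGroup.T]
  rw [slash_apply, hj, hT, hc]
  simp

lemma preservesCharSpace_S {m : ℕ} (hm : 0 < m) : PreservesCharSpace m ModularGroup.S := by
  refine ⟨fun τ z h => ?_, slash_span_closed ?_⟩
  · have hj : autFactor ModularGroup.S τ = τ := by simp [autFactor, ModularGroup.S]
    have hS : ((ModularGroup.S • τ : ℍ) : ℂ) = -1 / τ := by
      rw [coe_smul_eq, hj]
      simp [ModularGroup.S]
    obtain ⟨⟨h11, h00⟩, ⟨-, h01⟩, -, h10⟩ := h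
    rw [AllRegular, Regular, Regular, Regular, hj, hS]
    exact ⟨⟨vartheta_S_ne_zero τ.im_pos h11, vartheta_S_ne_zero τ.im_pos h00⟩,
      -- S exchanges ϑ₀₁ and ϑ₁₀.
      ⟨vartheta_S_ne_zero τ.im_pos h11, vartheta_S_ne_zero τ.im_pos h10⟩,
      ⟨vartheta_S_ne_zero τ.im_pos h11, vartheta_S_ne_zero τ.im_pos h01⟩⟩
  · have hplus : ∀ m₂ : ℕ, ∃ G ∈ charSpace m, ∀ (τ : ℍ) z, AllRegular τ z →
        slash m ModularGroup.S (fun τ z => chPlus m m₂ τ z) τ z = G τ z := fun m₂ => by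
      refine ⟨_, Submodule.add_mem _ (Submodule.smul_mem _
        (-(1 / 2) * cexp (-(π * I * m) / 4) *
          (1 + cexp (π * I * (m₂ + 1 : ℕ)) * cexp (π * I * m / 2))) (chPlus_one_mem m))
        (Submodule.smul_mem _ (-(1 / 2) * cexp (-(π * I * m) / 4) *
          (cexp (π * I * (m₂ + 1 : ℕ)) * cexp (π * I * m / 2) - 1)) (chPlus_zero_mem m)),
        fun τ z h => ?_⟩
      rw [slash_S m (chPlus m m₂), chPlus_S hm m₂ τ.im_pos h.1.2]
      simp only [Pi.add_apply, Pi.smul_apply, smul_eq_mul]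
      field_simp
      ring
    have hminus : ∀ m₂ : ℕ, ∃ G ∈ charSpace m, ∀ (τ : ℍ) z, AllRegular τ z →
        slash m ModularGroup.S (fun τ z => chMinus m m₂ τ z) τ z = G τ z := fun m₂ => by
      refine ⟨_, Submodule.add_mem _ (Submodule.smul_mem _ (-(1 / 2)) (chTwMinus_mem m))
        (Submodule.smul_mem _ (-(1 / 2) *
          (cexp (π * I * (m₂ + 1 : ℕ)) * cexp (π * I * m / 2))) (chTwPlus_mem m)),
        fun τ z h => ?_⟩
      rw [slash_S m (chMinus m m₂), chMinus_S hm m₂ τ.im_pos h.2.2.2]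
      simp only [Pi.add_apply, Pi.smul_apply, smul_eq_mul]
      field_simp
      ring
    intro F hF
    simp only [Set.mem_insert_iff, Set.mem_singleton_iff] at hF
    rcases hF with rfl | rfl | rfl | rfl | rfl | rfl
    · exact hplus 0
    · exact hplus 1
    · exact hminus 0
    · exact hminus 1
    · refine ⟨_, Submodule.smul_mem _ (cexp (-(π * I * m) / 2))
        (Submodule.sub_mem _ (chMinus_zero_mem m) (chMinus_one_mem m)), fun τ z h => ?_⟩
      rw [slash_S m (chTwPlus m (par m)), chTwPlus_S hm τ.im_pos h.2.1.2]
      simp only [Pi.sub_apply, Pi.smul_apply, smul_eq_mul]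
      field_simp
    · refine ⟨_, Submodule.neg_mem _
        (Submodule.add_mem _ (chMinus_zero_mem m) (chMinus_one_mem m)), fun τ z h => ?_⟩
      rw [slash_S m (chTwMinus m 1), chTwMinus_S hm τ.im_pos h.2.1.2]
      simp only [Pi.add_apply, Pi.neg_apply]
      field_simp

lemma preservesCharSpace_T {m : ℕ} (hm : 0 < m) : PreservesCharSpace m ModularGroup.T := by
  refine ⟨fun τ z h => ?_, slash_span_closed ?_⟩
  · have hj : autFactor ModularGroup.T τ = 1 := by simp [autFactor, ModularGroup.T]
    have hT : ((ModularGroup.T • τ : ℍ) : ℂ) = τ + 1 := by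
      rw [coe_smul_eq, hj]
      simp [ModularGroup.T]
    obtain ⟨⟨h11, h00⟩, ⟨-, h01⟩, -, h10⟩ := h
    rw [AllRegular, Regular, Regular, Regular, hj, hT, div_one, vartheta_one_T, vartheta_one_T,
      vartheta_zero_zero_T, vartheta_zero_one_T]
    have h11' := mul_ne_zero (Complex.exp_ne_zero (π * I / 4)) h11
    exact ⟨⟨h11', h01⟩, ⟨h11', h00⟩, h11', mul_ne_zero (Complex.exp_ne_zero _) h10⟩
  · intro F hF
    simp only [Set.mem_insert_iff, Set.mem_singleton_iff] at hF
    rcases hF with rfl | rfl | rfl | rfl | rfl | rfl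
    · refine ⟨_, Submodule.smul_mem _ (cexp (-((m : ℂ) / 8 + 11 / 24) * π * I))
        (chMinus_zero_mem m), fun τ z h => ?_⟩
      rw [slash_T m (chPlus m 0), chPlus_T hm 0 τ.im_pos h.2.1.2]
      rfl
    · refine ⟨_, Submodule.smul_mem _ (cexp (-((m : ℂ) / 8 + 11 / 24) * π * I))
        (chMinus_one_mem m), fun τ z h => ?_⟩
      rw [slash_T m (chPlus m 1), chPlus_T hm 1 τ.im_pos h.2.1.2]
      rfl
    · refine ⟨_, Submodule.smul_mem _ (cexp (π * I * (0 + 1 : ℕ)) * cexp (-((m : ℂ) / 8 + 11 / 24) * π * I))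
        (chPlus_zero_mem m), fun τ z h => ?_⟩
      rw [slash_T m (chMinus m 0), chMinus_T hm 0 τ.im_pos h.1.2]
      rfl
    · refine ⟨_, Submodule.smul_mem _ (cexp (π * I * (1 + 1 : ℕ)) * cexp (-((m : ℂ) / 8 + 11 / 24) * π * I))
        (chPlus_one_mem m), fun τ z h => ?_⟩
      rw [slash_T m (chMinus m 1), chMinus_T hm 1 τ.im_pos h.1.2]
      rfl
    · refine ⟨_, Submodule.smul_mem _ (cexp (((m : ℂ) / 2 - 1 / 12) * π * I))
        (chTwPlus_mem m), fun τ z h => ?_⟩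
      rw [slash_T m (chTwPlus m (par m)), chTwPlus_T hm τ.im_pos h.2.2.2]
      rfl
    · refine ⟨_, Submodule.smul_mem _ (cexp (-(π * I) / 12))
        (chTwMinus_mem m), fun τ z h => ?_⟩
      rw [slash_T m (chTwMinus m 1), chTwMinus_T hm τ.im_pos h.2.2.2]
      rfl

lemma preservesCharSpace_one (m : ℕ) : PreservesCharSpace m 1 := by
  have hj : ∀ τ, autFactor 1 τ = 1 := fun τ => by simp [autFactor]
  refine ⟨fun τ z h => by rwa [one_smul, hj, div_one], fun F hF => ⟨F, hF, fun τ z _ => ?_⟩⟩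
  rw [slash_apply, one_smul, hj]
  simp

/-- Reduction by S and T brings an integer matrix of fixed determinant to a representative. In
determinant 1 the only one is the identity. -/
theorem preservesCharSpace {m : ℕ} (hm : 0 < m) (γ : SL(2, ℤ)) : PreservesCharSpace m γ := by
  have hone : ∀ A : SL(2, ℤ), A.1 1 0 = 0 → 0 < A.1 0 0 → |A.1 0 1| < |A.1 1 1| → A = 1 :=
    fun A h1 h2 h3 => FixedDetMatrices.reps_one_id A h1 h2 h3
  induction γ using (FixedDetMatrices.induction_on one_ne_zero) with
  | h0 A a1 a4 _ a6 =>
    rw [hone A a1 a4 a6]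
    exact preservesCharSpace_one m
  | hS B hB => exact (preservesCharSpace_S hm).mul hB
  | hT B hB => exact (preservesCharSpace_T hm).mul hB

end

end N3

theorem mainTheorem5 (m : ℕ) (hm : 0 < m) :
    -- S-transformation
    (∀ (τ : ℍ) (z : ℂ),
      (N3.Regular 0 0 τ z →
        N3.chPlus m 0 (-1 / (τ : ℂ)) (z / τ) =
          -(1 / 2) * Complex.exp (-(Real.pi * Complex.I * m) / 4)
            * Complex.exp (Real.pi * Complex.I * m * z ^ 2 / (2 * τ)) *
            ((1 - Complex.exp (Real.pi * Complex.I * m / 2)) * N3.chPlus m 1 τ z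
              - (Complex.exp (Real.pi * Complex.I * m / 2) + 1) * N3.chPlus m 0 τ z)) ∧
      (N3.Regular 0 0 τ z →
        N3.chPlus m 1 (-1 / (τ : ℂ)) (z / τ) =
          -(1 / 2) * Complex.exp (-(Real.pi * Complex.I * m) / 4)
            * Complex.exp (Real.pi * Complex.I * m * z ^ 2 / (2 * τ)) *
            ((1 + Complex.exp (Real.pi * Complex.I * m / 2)) * N3.chPlus m 1 τ z
              + (Complex.exp (Real.pi * Complex.I * m / 2) - 1) * N3.chPlus m 0 τ z)) ∧
      (N3.Regular 1 0 τ z →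
        N3.chMinus m 0 (-1 / (τ : ℂ)) (z / τ) =
          -(1 / 2) * Complex.exp (Real.pi * Complex.I * m * z ^ 2 / (2 * τ)) *
            (N3.chTwMinus m 1 τ z
              - Complex.exp (Real.pi * Complex.I * m / 2) * N3.chTwPlus m (N3.par m) τ z)) ∧
      (N3.Regular 1 0 τ z →
        N3.chMinus m 1 (-1 / (τ : ℂ)) (z / τ) =
          -(1 / 2) * Complex.exp (Real.pi * Complex.I * m * z ^ 2 / (2 * τ)) *
            (N3.chTwMinus m 1 τ z
              + Complex.exp (Real.pi * Complex.I * m / 2) * N3.chTwPlus m (N3.par m) τ z)) ∧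
      (N3.Regular 0 1 τ z →
        N3.chTwPlus m (N3.par m) (-1 / (τ : ℂ)) (z / τ) =
          Complex.exp (-(Real.pi * Complex.I * m) / 2)
            * Complex.exp (Real.pi * Complex.I * m * z ^ 2 / (2 * τ)) *
            (N3.chMinus m 0 τ z - N3.chMinus m 1 τ z)) ∧
      (N3.Regular 0 1 τ z →
        N3.chTwMinus m 1 (-1 / (τ : ℂ)) (z / τ) =
          -Complex.exp (Real.pi * Complex.I * m * z ^ 2 / (2 * τ)) *
            (N3.chMinus m 0 τ z + N3.chMinus m 1 τ z))) ∧
    -- T-transformation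
    (∀ (τ : ℍ) (z : ℂ),
      (N3.Regular 0 1 τ z →
        N3.chPlus m 0 ((τ : ℂ) + 1) z =
          Complex.exp (-((m : ℂ) / 8 + 11 / 24) * Real.pi * Complex.I) * N3.chMinus m 0 τ z) ∧
      (N3.Regular 0 1 τ z →
        N3.chPlus m 1 ((τ : ℂ) + 1) z =
          Complex.exp (-((m : ℂ) / 8 + 11 / 24) * Real.pi * Complex.I) * N3.chMinus m 1 τ z) ∧
      (N3.Regular 0 0 τ z →
        N3.chMinus m 0 ((τ : ℂ) + 1) z =
          -Complex.exp (-((m : ℂ) / 8 + 11 / 24) * Real.pi * Complex.I) * N3.chPlus m 0 τ z) ∧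
      (N3.Regular 0 0 τ z →
        N3.chMinus m 1 ((τ : ℂ) + 1) z =
          Complex.exp (-((m : ℂ) / 8 + 11 / 24) * Real.pi * Complex.I) * N3.chPlus m 1 τ z) ∧
      (N3.Regular 1 0 τ z →
        N3.chTwPlus m (N3.par m) ((τ : ℂ) + 1) z =
          Complex.exp (((m : ℂ) / 2 - 1 / 12) * Real.pi * Complex.I)
            * N3.chTwPlus m (N3.par m) τ z) ∧
      (N3.Regular 1 0 τ z →
        N3.chTwMinus m 1 ((τ : ℂ) + 1) z =
          Complex.exp (-(Real.pi * Complex.I) / 12) * N3.chTwMinus m 1 τ z)) ∧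
    -- The span of the six functions is closed under the action of SL₂(ℤ); the functions are
    -- compared at the points where all of them are regular.
    (∀ (γ : SL(2, ℤ)), ∀ F ∈ N3.charSpace m, ∃ G ∈ N3.charSpace m,
      ∀ (τ : ℍ) (z : ℂ), N3.Regular 0 0 τ z → N3.Regular 0 1 τ z → N3.Regular 1 0 τ z →
        N3.slash m γ F τ z = G τ z) := by
  -- The sign exp(πi(m₂ + 1)) is -1 for m₂ = 0 and 1 for m₂ = 1. It is the only difference between
  -- the paired formulas.
  have hodd := N3.exp_pi_I_mul_one
  have heven := N3.exp_pi_I_mul_two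
  refine ⟨fun τ z => ⟨fun h => ?_, fun h => ?_, fun h => ?_, fun h => ?_, fun h => ?_, fun h => ?_⟩,
    fun τ z => ⟨fun h => ?_, fun h => ?_, fun h => ?_, fun h => ?_, fun h => ?_, fun h => ?_⟩,
    fun γ F hF => ?_⟩
  · rw [N3.chPlus_S hm 0 τ.im_pos h.2, zero_add, hodd]
    ring
  · rw [N3.chPlus_S hm 1 τ.im_pos h.2, one_add_one_eq_two, heven]
    ring
  · rw [N3.chMinus_S hm 0 τ.im_pos h.2, zero_add, hodd]
    ring
  · rw [N3.chMinus_S hm 1 τ.im_pos h.2, one_add_one_eq_two, heven]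
    ring
  · exact N3.chTwPlus_S hm τ.im_pos h.2
  · exact N3.chTwMinus_S hm τ.im_pos h.2
  · exact N3.chPlus_T hm 0 τ.im_pos h.2
  · exact N3.chPlus_T hm 1 τ.im_pos h.2
  · rw [N3.chMinus_T hm 0 τ.im_pos h.2, zero_add, hodd]
    ring
  · rw [N3.chMinus_T hm 1 τ.im_pos h.2, one_add_one_eq_two, heven]
    ring
  · exact N3.chTwPlus_T hm τ.im_pos h.2
  · exact N3.chTwMinus_T hm τ.im_pos h.2
  · obtain ⟨G, hG, e⟩ := (N3.preservesCharSpace hm γ).2 F hF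
    exact ⟨G, hG, fun τ z h1 h2 h3 => e τ z ⟨h1, h2, h3⟩⟩
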